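/- Let $\mathbb S^2\times\mathbb R$ be the Riemannian product of the unit sphere $\mathbb S^2\subset\mathbb R^3$ and the real line, with metric $g=g_{\mathbb S^2}+dy^2$, where $y$ is the coordinate on $\mathbb R$ and $dV_{\mathbb S^2}$ is the area form of $\mathbb S^2$. A homogeneous Riemannian structure tensor on a Riemannian manifold $(M,g)$ with Levi-Civita connection $\nabla$ and curvature tensor $R$ is a smooth $(1,2)$-tensor field $T$ such that $\tilde\nabla g=0$, $\tilde\nabla R=0$ and $\tilde\nabla T=0$ for $\tilde\nabla=\nabla-T$. Two such tensors $T$ on $(M,g)$ and $T'$ on $(M',g')$ are isomorphic if $\phi_*(T_XY)=T'_{\phi_*X}\phi_*Y$ for some isometry $\phi\colon(M,g)\to(M',g')$ and all vector fields $X,Y$ on $M$. For $\lambda\in\mathbb R$ let $T^\lambda$ be the $(1,2)$-tensor field on $\mathbb S^2\times\mathbb R$ with $g(T^\lambda_XY,Z)=\lambda\,dy(X)\,dV_{\mathbb S^2}(Y,Z)$, i.e. $T^\lambda=\lambda\,dy\otimes dV_{\mathbb S^2}$. Then: 1. The homogeneous Riemannian structure tensors on $\mathbb S^2\times\mathbb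 R$ are exactly the $T^\lambda$, $\lambda\in\mathbb R$. 2. Every homogeneous Riemannian structure tensor on $\mathbb S^2\times\mathbb R$ is isomorphic to $T^\lambda$ for a unique $\lambda\ge 0$. 3. $T^\lambda$ and $T^\mu$ are isomorphic if and only if $\lambda=\pm\mu$. 4. The group $G=\mathrm{SO}(3)\times\mathbb R$ acts on $\mathbb S^2\times\mathbb R$ by $(A,t)\cdot(x,y)=(Ax,y+t)$, transitively, effectively and by isometries, and the isotropy group $H$ of $o=((1,0,0),0)$ is isomorphic to $\mathrm{SO}(2)$, so that $\mathbb S^2\times\mathbb R=\mathrm{SO}(3)\times\mathbb R/\mathrm{SO}(2)$. A $(1,2)$-tensor field $T$ on $\mathbb S^2\times\mathbb R$ is a homogeneous Riemannian structure tensor if and only if it comes from a reductive decomposition of this coset space, that is, if and only if there is an $\mathrm{Ad}(H)$-invariant linear complement $\mathfrak m$ of the Lie algebra $\mathfrak h$ of $H$ in $\mathfrak g=\mathfrak{so}(3)\oplus\mathbb R$ such that $T=\nabla-\tilde\nabla$, where $\tilde\nabla$ is the $G$-invariant connection with $(\tilde\nabla_{X^*}Y^*)_o=-([X,Y]_{\mathfrak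 m})^*_o$ for $X,Y\in\mathfrak m$; here $X^*_p=\frac{d}{dt}\big|_{t=0}\exp(tX)\cdot p$, and $Z_{\mathfrak m}$ denotes the $\mathfrak m$-component of $Z\in\mathfrak g=\mathfrak m\oplus\mathfrak h$. -/

import Mathlib

open scoped Manifold ContDiff Bundle

noncomputable section

namespace HomogeneousStructures

/-! ### Homogeneous Riemannian structure tensors on a Riemannian manifold -/

section General

variable {E : Type*} [NormedAddCommGroup E] [NormedSpace ℝ E]
  {H : Type*} [TopologicalSpace H] (I : ModelWithCorners ℝ E H)
  (M : Type*) [TopologicalSpace M] [ChartedSpace H M] [IsManifold I ∞ M]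

/-- Smooth Riemannian metrics on `M`. -/
abbrev RiemMetric : Type _ :=
  Bundle.ContMDiffRiemannianMetric I ∞ E (fun x : M => TangentSpace I x)

/-- Affine connections on `M`; `∇ Y p (X p)` is the value of `∇_X Y` at `p`. -/
abbrev AffineConnection : Type _ :=
  CovariantDerivative I E (fun x : M => TangentSpace I x)

/-- Vector fields on `M`, with no regularity. -/
abbrev VField : Type _ := (p : M) → TangentSpace I p

/-- Fields of type `(1,2)` on `M`, with no regularity; `T p u v` is `T_u v` for `u v ∈ T_p M`. -/
abbrev Field12 : Type _ :=
  (p : M) → TangentSpace I p →L[ℝ] TangentSpace I p →L[ℝ] TangentSpace I p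

variable {I M}

/-- `X` is a `C^∞` vector field. -/
def IsSmoothField (X : VField I M) : Prop :=
  ContMDiff I I.tangent ∞ (fun p => (⟨p, X p⟩ : TangentBundle I M))

/-- `T` is a `C^∞` tensor field: it sends smooth vector fields to smooth vector fields. -/
def IsSmoothTensor (T : Field12 I M) : Prop :=
  ∀ X Y : VField I M, IsSmoothField X → IsSmoothField Y → IsSmoothField (fun p => T p (X p) (Y p))

/-- The vector field `∇_X Y`. -/
def covDeriv (D : AffineConnection I M) (X Y : VField I M) : VField I M :=
  fun p => D Y p (X p)

/-- The connection `∇ - T`, that is `(X, Y) ↦ ∇_X Y - T_X Y`. -/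
def subTensor (D : AffineConnection I M) (T : Field12 I M) : AffineConnection I M :=
  D.addOneForm (fun p => -ContinuousLinearMap.flip (E := E) (F := E) (G := E) (T p))

lemma subTensor_apply (D : AffineConnection I M) (T : Field12 I M) (Y : VField I M) (p : M)
    (u : TangentSpace I p) : subTensor D T Y p u = D Y p u - T p u (Y p) := by
  exact (sub_eq_add_neg _ _).symm

variable [FiniteDimensional ℝ E]

/-- `∇ g = 0`. -/
def IsMetricConnection (g : RiemMetric I M) (D : AffineConnection I M) : Prop :=
  letI : Bundle.RiemannianBundle (fun x : M => TangentSpace I x) := ⟨g.toRiemannianMetric⟩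
  CovariantDerivative.IsMetricCompatible (V := fun x : M => TangentSpace I x) D

/-- `∇` is the Levi-Civita connection of `g`. -/
structure IsLeviCivita (g : RiemMetric I M) (D : AffineConnection I M) : Prop where
  metric : IsMetricConnection g D
  torsion_free : D.torsion = 0

/-- The curvature `R(X, Y) Z = ∇_X ∇_Y Z - ∇_Y ∇_X Z - ∇_[X, Y] Z`. -/
def curvature (D : AffineConnection I M) (X Y Z : VField I M) : VField I M :=
  covDeriv D X (covDeriv D Y Z) - covDeriv D Y (covDeriv D X Z) -
    covDeriv D (VectorField.mlieBracket I X Y) Z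

/-- The `(1,2)`-tensor field `T` is parallel for the connection `D`. -/
def IsParallelTensor (D : AffineConnection I M) (T : Field12 I M) : Prop :=
  ∀ W X Y : VField I M, IsSmoothField W → IsSmoothField X → IsSmoothField Y → ∀ p : M,
    covDeriv D W (fun q => T q (X q) (Y q)) p =
      T p (covDeriv D W X p) (Y p) + T p (X p) (covDeriv D W Y p)

/-- The curvature tensor of `D₀` is parallel for the connection `D`. -/
def IsParallelCurvature (D D₀ : AffineConnection I M) : Prop :=
  ∀ W X Y Z : VField I M,
    IsSmoothField W → IsSmoothField X → IsSmoothField Y → IsSmoothField Z → ∀ p : M,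
    covDeriv D W (curvature D₀ X Y Z) p =
      curvature D₀ (covDeriv D W X) Y Z p + curvature D₀ X (covDeriv D W Y) Z p +
        curvature D₀ X Y (covDeriv D W Z) p

/-- `T` is a homogeneous Riemannian structure tensor on `(M, g)`: a smooth `(1,2)`-tensor field
such that `g`, the curvature of the Levi-Civita connection `∇` of `g`, and `T` itself are parallel
for the connection `∇ - T`. -/
structure IsHomogeneousStructure (g : RiemMetric I M) (T : Field12 I M) : Prop where
  smooth : IsSmoothTensor T
  exists_leviCivita : ∃ D : AffineConnection I M, IsLeviCivita g D ∧
    IsMetricConnection g (subTensor D T) ∧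
    IsParallelCurvature (subTensor D T) D ∧
    IsParallelTensor (subTensor D T) T

variable {E' : Type*} [NormedAddCommGroup E'] [NormedSpace ℝ E']
  {H' : Type*} [TopologicalSpace H'] {I' : ModelWithCorners ℝ E' H'}
  {M' : Type*} [TopologicalSpace M'] [ChartedSpace H' M'] [IsManifold I' ∞ M']

/-- The differential of `φ` preserves the metrics. -/
def PreservesMetric (g : RiemMetric I M) (g' : RiemMetric I' M') (φ : M → M') : Prop :=
  ∀ (p : M) (u v : TangentSpace I p),
    g'.inner (φ p) (mfderiv I I' φ p u) (mfderiv I I' φ p v) = g.inner p u v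

/-- `φ_* (T_u v) = T'_{φ_* u} φ_* v`. -/
def Intertwines (φ : M → M') (T : Field12 I M) (T' : Field12 I' M') : Prop :=
  ∀ (p : M) (u v : TangentSpace I p),
    mfderiv I I' φ p (T p u v) = T' (φ p) (mfderiv I I' φ p u) (mfderiv I I' φ p v)

/-- `T` on `(M, g)` and `T'` on `(M', g')` are isomorphic: some isometry
`(M, g) → (M', g')` carries `T` to `T'`. -/
def IsIsomorphic (g : RiemMetric I M) (T : Field12 I M) (g' : RiemMetric I' M')
    (T' : Field12 I' M') : Prop :=
  ∃ φ : Diffeomorph I I' M M' ∞, PreservesMetric g g' φ ∧ Intertwines φ T T'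

end General

/-! ### The Riemannian product `S² × ℝ` -/

/-- Euclidean `3`-space. -/
abbrev E3 : Type := EuclideanSpace ℝ (Fin 3)

/-- The unit sphere `S²`. -/
abbrev S2 : Type := Metric.sphere (0 : E3) 1

/-- The manifold `S² × ℝ`. -/
abbrev S2R : Type := S2 × ℝ

/-- The model vector space of `S² × ℝ`. -/
abbrev ModelE : Type := EuclideanSpace ℝ (Fin 2) × ℝ

/-- The model with corners of `S² × ℝ`. -/
abbrev IS2R : ModelWithCorners ℝ ModelE (ModelProd (EuclideanSpace ℝ (Fin 2)) ℝ) :=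
  (𝓡 2).prod 𝓘(ℝ, ℝ)

/-- The differential of the map `(x, y) ↦ x ∈ ℝ³` on `S² × ℝ`. -/
def dx (p : S2R) : TangentSpace IS2R p →L[ℝ] E3 :=
  mvfderiv IS2R (fun q : S2R => (q.1 : E3)) p

/-- The differential of the coordinate `y` on `S² × ℝ`. -/
def dy (p : S2R) : TangentSpace IS2R p →L[ℝ] ℝ :=
  mvfderiv IS2R (fun q : S2R => q.2) p


instance (p : S2R) : FiniteDimensional ℝ (TangentSpace IS2R p) :=
  inferInstanceAs (FiniteDimensional ℝ ModelE)

instance (p : S2R) : T2Space (TangentSpace IS2R p) :=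
  inferInstanceAs (T2Space ModelE)

/-- The bilinear form `(u, v) ↦ ⟨A u, A v⟩ + B u * B v`. -/
def pullbackInner (A : ModelE →L[ℝ] E3) (B : ModelE →L[ℝ] ℝ) : ModelE →L[ℝ] ModelE →L[ℝ] ℝ :=
  (ContinuousLinearMap.bilinearComp (σ₁₃ := RingHom.id ℝ) (σ₂₃ := RingHom.id ℝ)
    (innerSL ℝ : E3 →L[ℝ] E3 →L[ℝ] ℝ) A A : ModelE →L[ℝ] ModelE →L[ℝ] ℝ) + (ContinuousLinearMap.mul ℝ ℝ).bilinearComp B B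

/-- The inner product `⟨dx u, dx v⟩ + dy u * dy v` on the tangent space at `p`. -/
def gInner (p : S2R) : TangentSpace IS2R p →L[ℝ] TangentSpace IS2R p →L[ℝ] ℝ :=
  pullbackInner (dx p) (dy p)

lemma gInner_apply (p : S2R) (u v : TangentSpace IS2R p) :
    gInner p u v = inner ℝ (dx p u) (dx p v) + dy p u * dy p v := by
  rfl

lemma contMDiff_incl : ContMDiff IS2R 𝓘(ℝ, E3) ω (fun q : S2R => (q.1 : E3)) := by
  have : Fact (Module.finrank ℝ E3 = 2 + 1) := ⟨by simp⟩
  exact (contMDiff_coe_sphere (n := 2) (E := E3)).comp contMDiff_fst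

lemma dx_eq (p : S2R) (v : TangentSpace IS2R p) :
    dx p v = mvfderiv (𝓡 2) ((↑) : S2 → E3) p.1 (v : ModelE).1 := by
  have : Fact (Module.finrank ℝ E3 = 2 + 1) := ⟨by simp⟩
  have h : MDifferentiableAt (𝓡 2) 𝓘(ℝ, E3) ((↑) : S2 → E3) p.1 :=
    (contMDiff_coe_sphere (n := 2) (m := 1) (E := E3)).mdifferentiableAt one_ne_zero
  have h1 := mfderiv_comp (I := IS2R) (I' := 𝓡 2) (I'' := 𝓘(ℝ, E3)) (f := (Prod.fst : S2R → S2))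
    p h mdifferentiableAt_fst
  rw [mfderiv_fst] at h1
  exact congrArg (fun L : ModelE →L[ℝ] E3 => L v) h1

lemma dy_eq (p : S2R) (v : TangentSpace IS2R p) : dy p v = (v : ModelE).2 := by
  have : mfderiv IS2R 𝓘(ℝ, ℝ) (fun q : S2R => q.2) p = _ := mfderiv_snd
  exact congrArg (fun L : ModelE →L[ℝ] ℝ => L v) this

lemma eq_zero_of_dx_dy (p : S2R) (v : TangentSpace IS2R p) (h1 : dx p v = 0) (h2 : dy p v = 0) :
    v = 0 := by
  have : Fact (Module.finrank ℝ E3 = 2 + 1) := ⟨by simp⟩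
  rw [dx_eq] at h1
  rw [dy_eq] at h2
  have := injective_mvfderiv_subtypeVal_sphere (n := 2) (E := E3) p.1
  have h3 : (v : ModelE).1 = 0 := this (h1.trans (map_zero _).symm)
  exact Prod.ext h3 h2

lemma gInner_pos (p : S2R) (v : TangentSpace IS2R p) (hv : v ≠ 0) : 0 < gInner p v v := by
  rw [gInner_apply]
  by_contra! h
  have h1 : 0 ≤ inner ℝ (dx p v) (dx p v) := real_inner_self_nonneg
  have h2 : 0 ≤ dy p v * dy p v := mul_self_nonneg _
  exact hv (eq_zero_of_dx_dy p v (inner_self_eq_zero.1 (by linarith : inner ℝ (dx p v) (dx p v) = 0))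
    (mul_self_eq_zero.1 (by linarith)))

lemma gInner_isVonNBounded (p : S2R) :
    Bornology.IsVonNBounded ℝ {v : TangentSpace IS2R p | gInner p v v < 1} := by
  let L : ModelE →L[ℝ] E3 × ℝ := ContinuousLinearMap.prod (dx p) (dy p)
  have hL : Function.Injective L := by
    rw [injective_iff_map_eq_zero]
    intro v hv
    exact eq_zero_of_dx_dy p v (congrArg Prod.fst hv) (congrArg Prod.snd hv)
  obtain ⟨K, hK, hK'⟩ := L.toLinearMap.exists_antilipschitzWith (LinearMap.ker_eq_bot.2 hL)
  have : Bornology.IsVonNBounded ℝ {v : ModelE | gInner p v v < 1} := by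
    rw [NormedSpace.isVonNBounded_iff, isBounded_iff_forall_norm_le]
    refine ⟨K * 1, fun v hv => ?_⟩
    have h0 : gInner p v v < 1 := hv
    replace h0 := (gInner_apply p v v).symm.trans_lt h0
    have h1 : ‖v‖ ≤ K * ‖L v‖ := by simpa using hK'.le_mul_norm (map_zero _) v
    have h2 : ‖dx p v‖ ≤ 1 := by
      have h3 := real_inner_self_eq_norm_sq (dx p v)
      have h2 : 0 ≤ dy p v * dy p v := mul_self_nonneg _
      nlinarith [norm_nonneg (dx p v)]
    have h3 : ‖dy p v‖ ≤ 1 := by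
      have h1 : 0 ≤ inner ℝ (dx p v) (dx p v) := real_inner_self_nonneg
      rw [Real.norm_eq_abs, abs_le]
      constructor <;> nlinarith
    refine h1.trans (mul_le_mul_of_nonneg_left ?_ K.2)
    exact max_le h2 h3
  exact this

lemma gInner_contMDiff : ContMDiff IS2R (IS2R.prod 𝓘(ℝ, ModelE →L[ℝ] ModelE →L[ℝ] ℝ)) ∞
    (fun p : S2R => Bundle.TotalSpace.mk' (ModelE →L[ℝ] ModelE →L[ℝ] ℝ)
      (E := fun p : S2R => TangentSpace IS2R p →L[ℝ] TangentSpace IS2R p →L[ℝ] ℝ) p (gInner p)) := by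
  intro p₀
  rw [Bundle.contMDiffAt_section]
  have hA : ContMDiffAt IS2R 𝓘(ℝ, ModelE →L[ℝ] E3) ∞ _ p₀ :=
    (contMDiff_incl p₀).mfderiv_const (m := ∞) (by simp)
  have hB : ContMDiffAt IS2R 𝓘(ℝ, ModelE →L[ℝ] ℝ) ∞ _ p₀ :=
    ((contMDiff_snd (n := ω) : ContMDiff IS2R 𝓘(ℝ, ℝ) ω (Prod.snd : S2R → ℝ)) p₀).mfderiv_const
      (m := ∞) (by simp)
  have hP : ContDiff ℝ ∞ (fun AB : (ModelE →L[ℝ] E3) × (ModelE →L[ℝ] ℝ) =>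
      pullbackInner AB.1 AB.2) := by
    rw [contDiff_clm_apply_iff]
    intro u
    rw [contDiff_clm_apply_iff]
    intro v
    change ContDiff ℝ ∞ (fun AB : (ModelE →L[ℝ] E3) × (ModelE →L[ℝ] ℝ) =>
      inner ℝ (AB.1 u) (AB.1 v) + AB.2 u * AB.2 v)
    exact (ContDiff.inner ℝ (by fun_prop) (by fun_prop)).add (by fun_prop)
  refine (hP.contMDiff.contMDiffAt.comp p₀ (hA.prodMk_space hB)).congr_of_eventuallyEq ?_
  have hmem := (trivializationAt ModelE (TangentSpace IS2R) p₀).open_baseSet.mem_nhds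
    (FiberBundle.mem_baseSet_trivializationAt ModelE (TangentSpace IS2R) p₀)
  filter_upwards [hmem] with p hp
  refine ContinuousLinearMap.ext fun u => ContinuousLinearMap.ext fun v => ?_
  have hp' : p ∈ (trivializationAt (ModelE →L[ℝ] ℝ)
      (fun x => TangentSpace IS2R x →L[ℝ] ℝ) p₀).baseSet := by
    rw [hom_trivializationAt_baseSet]
    exact ⟨hp, by simp⟩
  simp [hom_trivializationAt_apply, ContinuousLinearMap.inCoordinates, inTangentCoordinates,
    Bundle.Trivialization.linearMapAt_apply, -mfderiv_snd]
  refine (congrArg (fun L : ModelE →L[ℝ] ℝ => L v) (if_pos hp')).trans ?_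
  rfl

/-- The product metric `g_{S²} + dy²`, where `g_{S²}` is induced from `ℝ³`. -/
def metric : RiemMetric IS2R S2R where
  inner := gInner
  symm p u v := by rw [gInner_apply, gInner_apply, real_inner_comm, mul_comm]
  pos := gInner_pos
  isVonNBounded := gInner_isVonNBounded
  contMDiff := gInner_contMDiff

/-- The area form of the unit sphere, pulled back to `S² × ℝ`: at `(x, y)` it is
`(u, v) ↦ det (x, dx u, dx v)`. -/
def areaForm (p : S2R) : TangentSpace IS2R p →L[ℝ] TangentSpace IS2R p →L[ℝ] ℝ :=
  (LinearMap.mk₂ ℝ (fun u v => Matrix.det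
      (Matrix.of ![(p.1 : E3).ofLp, (dx p u).ofLp, (dx p v).ofLp]))
    (fun _ _ _ => by simp [Matrix.det_fin_three]; ring)
    (fun _ _ _ => by simp [Matrix.det_fin_three]; ring)
    (fun _ _ _ => by simp [Matrix.det_fin_three]; ring)
    (fun _ _ _ => by simp [Matrix.det_fin_three]; ring)).toContinuousBilinearMap

/-- `T^l = l dy ⊗ dV_{S²}`, as a `(1,2)`-tensor field: one index is raised with the metric. -/
def tensorT (l : ℝ) : Field12 IS2R S2R := fun p =>
  (dy p).smulRight (l • (metric.inner p).inverse.comp (areaForm p))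

/-- As a covariant tensor, `g(T^l_u v, w) = l dy(u) dV(v, w)`. -/
lemma inner_tensorT (l : ℝ) (p : S2R) (u v w : TangentSpace IS2R p) :
    metric.inner p (tensorT l p u v) w = l * (dy p u * areaForm p v w) := by
  have hinj : Function.Injective (metric.inner p) := by
    rw [injective_iff_map_eq_zero]
    intro a ha
    by_contra h
    have := metric.pos p a h
    rw [ha] at this
    simp at this
  have hdim : Module.finrank ℝ (TangentSpace IS2R p) =
      Module.finrank ℝ (TangentSpace IS2R p →L[ℝ] ℝ) := by
    rw [← (LinearMap.toContinuousLinearMap (𝕜 := ℝ) (E := TangentSpace IS2R p)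
      (F' := ℝ)).finrank_eq]
    exact (Subspace.dual_finrank_eq (K := ℝ) (V := TangentSpace IS2R p)).symm
  have hinv : (metric.inner p).IsInvertible :=
    ⟨(LinearEquiv.ofInjectiveOfFinrankEq (metric.inner p).toLinearMap hinj
      hdim).toContinuousLinearEquiv, by ext; rfl⟩
  have h : metric.inner p ((metric.inner p).inverse (areaForm p v)) = areaForm p v := by
    obtain ⟨e, he⟩ := hinv
    rw [← he]; simp
  simp [tensorT, h]
  ring

/-! ### The coset space `SO(3) × ℝ / SO(2)` -/

/-- The group `SO(3)`. -/
abbrev SO3 : Type := Matrix.specialOrthogonalGroup (Fin 3) ℝ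

/-- The group `SO(3) × ℝ`. -/
abbrev G : Type := SO3 × Multiplicative ℝ

lemma SO3.transpose_mul (A : SO3) : (A : Matrix (Fin 3) (Fin 3) ℝ).transpose * A = 1 :=
  (Matrix.mem_orthogonalGroup_iff' _ _).1 (Matrix.mem_specialOrthogonalGroup_iff.1 A.2).1

lemma SO3.coe_inv (A : SO3) :
    ((A⁻¹ : SO3) : Matrix (Fin 3) (Fin 3) ℝ) = (A : Matrix (Fin 3) (Fin 3) ℝ).transpose := rfl

lemma SO3.norm_mulVec (A : SO3) (x : E3) :
    ‖(WithLp.toLp 2 ((A : Matrix (Fin 3) (Fin 3) ℝ).mulVec x.ofLp) : E3)‖ = ‖x‖ := by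
  have h : inner ℝ (WithLp.toLp 2 ((A : Matrix (Fin 3) (Fin 3) ℝ).mulVec x.ofLp) : E3)
      (WithLp.toLp 2 ((A : Matrix (Fin 3) (Fin 3) ℝ).mulVec x.ofLp) : E3) = inner ℝ x x := by
    simp only [EuclideanSpace.inner_eq_star_dotProduct, star_trivial]
    rw [Matrix.dotProduct_mulVec, Matrix.vecMul_mulVec, SO3.transpose_mul, Matrix.vecMul_one]
  rw [real_inner_self_eq_norm_sq, real_inner_self_eq_norm_sq] at h
  exact (sq_eq_sq₀ (norm_nonneg _) (norm_nonneg _)).1 h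

/-- Rotations act on the unit sphere. -/
def rotate (A : SO3) (x : S2) : S2 :=
  ⟨WithLp.toLp 2 ((A : Matrix (Fin 3) (Fin 3) ℝ).mulVec (x : E3).ofLp), by
    rw [mem_sphere_zero_iff_norm, SO3.norm_mulVec, norm_eq_of_mem_sphere x]⟩

/-- `SO(3) × ℝ` acts on `S² × ℝ` by `(A, t) (x, y) = (A x, y + t)`. -/
instance instSMulG : SMul G S2R where
  smul a p := (rotate a.1 p.1, p.2 + Multiplicative.toAdd a.2)

instance instMulActionG : MulAction G S2R where
  one_smul p := by
    refine Prod.ext (Subtype.ext ?_) (add_zero _)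
    change WithLp.toLp 2 ((1 : Matrix (Fin 3) (Fin 3) ℝ).mulVec (p.1 : E3).ofLp) = (p.1 : E3)
    rw [Matrix.one_mulVec]
  mul_smul a b p := by
    refine Prod.ext (Subtype.ext ?_) ?_
    · change WithLp.toLp 2 (((a.1 : Matrix (Fin 3) (Fin 3) ℝ) * b.1).mulVec (p.1 : E3).ofLp) =
        WithLp.toLp 2 ((a.1 : Matrix (Fin 3) (Fin 3) ℝ).mulVec
          ((b.1 : Matrix (Fin 3) (Fin 3) ℝ).mulVec (p.1 : E3).ofLp))
      rw [Matrix.mulVec_mulVec]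
    · change p.2 + (Multiplicative.toAdd a.2 + Multiplicative.toAdd b.2) =
        p.2 + Multiplicative.toAdd b.2 + Multiplicative.toAdd a.2
      ring

/-- The origin `o = (1, 0, 0, 0)`. -/
def origin : S2R := (⟨EuclideanSpace.single 0 1, by simp⟩, 0)

/-- The isotropy group of the origin. -/
abbrev isotropy : Subgroup G := MulAction.stabilizer G origin

/-- The Lie algebra `so(3) ⊕ ℝ` of `SO(3) × ℝ`. -/
abbrev LieG : Type := LieAlgebra.Orthogonal.so (Fin 3) ℝ × ℝ

/-- The bracket of `so(3) ⊕ ℝ`. -/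
def bracket (X Y : LieG) : LieG := (⁅X.1, Y.1⁆, 0)

lemma exp_mem_SO3 {A : Matrix (Fin 3) (Fin 3) ℝ} (hA : A.transpose = -A) :
    NormedSpace.exp A ∈ Matrix.specialOrthogonalGroup (Fin 3) ℝ := by
  have horth (B : Matrix (Fin 3) (Fin 3) ℝ) (hB : B.transpose = -B) :
      NormedSpace.exp B * (NormedSpace.exp B).transpose = 1 := by
    rw [← Matrix.exp_transpose, hB, Matrix.exp_neg]
    exact Matrix.mul_nonsing_inv _ ((Matrix.isUnit_iff_isUnit_det _).1 (Matrix.isUnit_exp B))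
  refine Matrix.mem_specialOrthogonalGroup_iff.2
    ⟨(Matrix.mem_orthogonalGroup_iff _ _).2 (horth A hA), ?_⟩
  set B : Matrix (Fin 3) (Fin 3) ℝ := (1 / 2 : ℝ) • A with hB
  have hBt : B.transpose = -B := by rw [hB, Matrix.transpose_smul, hA, smul_neg]
  have h2 : A = B + B := by rw [hB, ← add_smul]; norm_num
  have h3 := congrArg Matrix.det (horth B hBt)
  rw [Matrix.det_mul, Matrix.det_transpose, Matrix.det_one] at h3
  rw [h2, Matrix.exp_add_of_commute _ _ (Commute.refl B), Matrix.det_mul, h3]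

lemma forall_exp_mulVec (A : Matrix (Fin 3) (Fin 3) ℝ) (v : Fin 3 → ℝ) :
    (∀ t : ℝ, (NormedSpace.exp (t • A)).mulVec v = v) ↔ A.mulVec v = 0 := by
  let _ : NormedRing (Matrix (Fin 3) (Fin 3) ℝ) := Matrix.linftyOpNormedRing
  let _ : NormedAlgebra ℝ (Matrix (Fin 3) (Fin 3) ℝ) := Matrix.linftyOpNormedAlgebra
  have hd (t : ℝ) : HasDerivAt (fun t : ℝ => (NormedSpace.exp (t • A)).mulVec v)
      ((NormedSpace.exp (t • A)).mulVec (A.mulVec v)) t := by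
    have h := hasDerivAt_exp_smul_const (𝕂 := ℝ) A t
    have := ((Matrix.mulVecBilin ℝ ℝ).flip v).toContinuousLinearMap.hasFDerivAt.comp_hasDerivAt t h
    rw [Matrix.mulVec_mulVec]
    exact this
  constructor
  · intro h
    have h1 := hd 0
    simp only [h, zero_smul, NormedSpace.exp_zero, Matrix.one_mulVec] at h1
    exact h1.unique (hasDerivAt_const _ _)
  · intro h t
    have h0 : ∀ s : ℝ, HasDerivAt (fun t : ℝ => (NormedSpace.exp (t • A)).mulVec v) 0 s := by
      intro s
      simpa [h] using hd s
    have h1 := is_const_of_deriv_eq_zero (fun s => (h0 s).differentiableAt)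
      (fun s => (h0 s).deriv) t 0
    simpa using h1

/-- The exponential map of `SO(3) × ℝ`. -/
def expG (X : LieG) : G :=
  (⟨NormedSpace.exp (X.1 : Matrix (Fin 3) (Fin 3) ℝ), 
    exp_mem_SO3 ((LieAlgebra.Orthogonal.mem_so _ _ _).1 X.1.2)⟩, Multiplicative.ofAdd X.2)

/-- The adjoint representation of `SO(3) × ℝ`. -/
def Ad (a : G) (X : LieG) : LieG :=
  (⟨(a.1 : Matrix (Fin 3) (Fin 3) ℝ) * X.1 * ((a.1⁻¹ : SO3) : Matrix (Fin 3) (Fin 3) ℝ), by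
    rw [LieAlgebra.Orthogonal.mem_so, SO3.coe_inv, Matrix.transpose_mul, Matrix.transpose_mul,
      Matrix.transpose_transpose, (LieAlgebra.Orthogonal.mem_so _ _ _).1 X.1.2]
    simp [mul_assoc]⟩, X.2)

/-- The vector field `X^*` on `S² × ℝ`, whose value at `p` is the velocity at `t = 0` of
`t ↦ exp (t X) p`. -/
def fundamentalField (X : LieG) : VField IS2R S2R := fun p =>
  mfderiv 𝓘(ℝ, ℝ) IS2R (fun t : ℝ => expG (t • X) • p) 0 (1 : ℝ)

lemma forall_expG_mem_isotropy (X : LieG) : (∀ t : ℝ, expG (t • X) ∈ isotropy) ↔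
    (X.1 : Matrix (Fin 3) (Fin 3) ℝ).mulVec (origin.1 : E3).ofLp = 0 ∧ X.2 = 0 := by
  have key (t : ℝ) : expG (t • X) ∈ isotropy ↔
      (NormedSpace.exp (t • (X.1 : Matrix (Fin 3) (Fin 3) ℝ))).mulVec (origin.1 : E3).ofLp =
        (origin.1 : E3).ofLp ∧ t * X.2 = 0 := by
    rw [MulAction.mem_stabilizer_iff]
    constructor
    · intro h
      refine ⟨congrArg (fun p : S2R => (p.1 : E3).ofLp) h, ?_⟩
      have h2 : (0 : ℝ) + t * X.2 = 0 := congrArg Prod.snd h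
      simpa using h2
    · rintro ⟨h1, h2⟩
      refine Prod.ext (Subtype.ext (congrArg (WithLp.toLp 2) h1)) ?_
      change (0 : ℝ) + t * X.2 = 0
      rw [h2, add_zero]
  simp only [key, forall_and, forall_exp_mulVec]
  refine and_congr_right fun _ => ⟨fun h => by simpa using h 1, fun h t => by rw [h, mul_zero]⟩

/-- The Lie algebra of the isotropy group. -/
def isotropyAlgebra : Submodule ℝ LieG where
  carrier := {X | ∀ t : ℝ, expG (t • X) ∈ isotropy}
  add_mem' {X Y} hX hY := by
    simp only [Set.mem_ofPred_eq, forall_expG_mem_isotropy] at hX hY ⊢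
    exact ⟨by simp [Matrix.add_mulVec, hX.1, hY.1], by simp [hX.2, hY.2]⟩
  zero_mem' := by
    rw [Set.mem_ofPred_eq, forall_expG_mem_isotropy]
    simp
  smul_mem' c X hX := by
    simp only [Set.mem_ofPred_eq, forall_expG_mem_isotropy] at hX ⊢
    exact ⟨by simp [Matrix.smul_mulVec, hX.1], by simp [hX.2]⟩

/-- `so(3) ⊕ ℝ = m ⊕ h` is a reductive decomposition: `m` is an `Ad(H)`-invariant complement of
the isotropy algebra `h`. -/
structure IsReductive (m : Submodule ℝ LieG) : Prop where
  isCompl : IsCompl m isotropyAlgebra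
  ad_mem : ∀ a ∈ isotropy, ∀ X ∈ m, Ad a X ∈ m

/-- `T = ∇ - ∇'`, where `∇` is the Levi-Civita connection of `S² × ℝ` and `∇'` is the canonical
connection of the reductive decomposition `so(3) ⊕ ℝ = m ⊕ h`: it is invariant under `SO(3) × ℝ`
(equivalently, `T` is, since the group acts by isometries) and
`(∇'_{X^*} Y^*)_o = -([X, Y]_m)^*_o` for `X, Y ∈ m`. -/
structure IsTensorOfDecomposition (m : Submodule ℝ LieG) (T : Field12 IS2R S2R) : Prop where
  reductive : IsReductive m
  invariant : ∀ a : G, Intertwines (fun p : S2R => a • p) T T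
  canonical : ∃ D : AffineConnection IS2R S2R, IsLeviCivita metric D ∧
    ∀ X ∈ m, ∀ Y ∈ m,
      covDeriv (subTensor D T) (fundamentalField X) (fundamentalField Y) origin =
        -fundamentalField (m.projection isotropyAlgebra reductive.isCompl (bracket X Y)) origin

end HomogeneousStructures
end

/-!
The proof works in the ambient space `ℝ³ × ℝ`: a tangent vector `u` at `p = (x, y)` is the pair
`(dx u, dy u)` with `dx u` orthogonal to `x`, every smooth tangent field comes from a smooth map
into `ℝ³ × ℝ` by orthogonal projection (`lift`), and the Levi-Civita connection is the ambient
derivative followed by that projection (`isLeviCivita_leviCivita`, `eq_leviCivita`). All identities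
between tensors become identities between inner and cross products in `ℝ³`.

*Classification.* As `∇ g = 0` and `∇ R = 0`, the conditions `∇' g = 0` and `∇' R = 0` on
`∇' = ∇ - T` are pointwise: each `T_u` is skew and acts trivially on `R`
(`isHomogeneousStructure_iff`). The line `∂_y` is the nullity of `R`, so `T_u` kills `∂_y` and
rotates the tangent plane of the sphere: `T_u v = ω(u) x × v` for a one-form `ω` (`dx_apply`).
Now `∇' T = 0` says `∇' ω = 0`. Hence `ω(∂_y)` is constant (`omega_vert`), and commuting the second
derivatives of the vector field `A` dual to `ω` on the sphere gives `|A|⁴ (|A|² + 1) = 0`, where the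
summand `1` is the curvature of the sphere; so `A = 0` (`omegaDual_eq_zero`) and `T = T^l`.

*Isomorphism classes.* The operator norm of `T^l` is `|l|` and the reflection `y ↦ -y` carries `T^l`
to `T^(-l)`.

*Reductive decompositions.* The half-turn about the first axis lies in the isotropy group `H`, so a
reductive complement `m` of `h` contains with `X` the sum of `X` and its image, which lies in
`h ⊕ ℝ`. As `m ∩ h = 0`, the rotation speed of `X ∈ m` about the first axis is `l` times its
translation speed, for a fixed `l` (`IsReductive.exists_le_complement`). For such `X` the canonical
connection at the origin is `∇ - T^l` (`canonical_iff`, `dx_tensorT_fundamentalField`), and both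
tensors are invariant under the transitive group, so they agree everywhere.
-/

noncomputable section

namespace HomogeneousStructures

/-! ### The cross product -/

/-- The cross product on Euclidean `3`-space, as a continuous bilinear map. -/
def cross : E3 →L[ℝ] E3 →L[ℝ] E3 :=
  (LinearMap.mk₂ ℝ (fun a b => (!₂[a 1 * b 2 - a 2 * b 1, a 2 * b 0 - a 0 * b 2,
      a 0 * b 1 - a 1 * b 0] : E3))
    (fun _ _ _ => by ext i; fin_cases i <;> simp <;> ring)
    (fun _ _ _ => by ext i; fin_cases i <;> simp <;> ring)
    (fun _ _ _ => by ext i; fin_cases i <;> simp <;> ring)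
    (fun _ _ _ => by ext i; fin_cases i <;> simp <;> ring)).toContinuousBilinearMap

@[simp] lemma cross_zero (a b : E3) : cross a b 0 = a 1 * b 2 - a 2 * b 1 := rfl
@[simp] lemma cross_one (a b : E3) : cross a b 1 = a 2 * b 0 - a 0 * b 2 := rfl
@[simp] lemma cross_two (a b : E3) : cross a b 2 = a 0 * b 1 - a 1 * b 0 := rfl

lemma inner_eq (a b : E3) : inner ℝ a b = a 0 * b 0 + a 1 * b 1 + a 2 * b 2 := by
  simp [EuclideanSpace.inner_eq_star_dotProduct, Matrix.vec3_dotProduct, mul_comm]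

lemma cross_self (a : E3) : cross a a = 0 := by
  ext i; fin_cases i <;> simp <;> ring

lemma cross_swap (a b : E3) : cross a b = -cross b a := by
  ext i; fin_cases i <;> simp <;> ring

lemma inner_cross_left (a b : E3) : inner ℝ a (cross a b) = 0 := by
  simp [inner_eq]; ring

lemma inner_cross_right (a b : E3) : inner ℝ b (cross a b) = 0 := by
  simp [inner_eq]; ring

lemma inner_cross_rotate (a b c : E3) : inner ℝ a (cross b c) = inner ℝ b (cross c a) := by
  simp [inner_eq]; ring

lemma cross_cross (a b c : E3) :
    cross a (cross b c) = inner ℝ a c • b - inner ℝ a b • c := by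
  ext i; fin_cases i <;> simp [inner_eq] <;> ring

lemma inner_cross_cross (a b c d : E3) :
    inner ℝ (cross a b) (cross c d) =
      inner ℝ a c * inner ℝ b d - inner ℝ a d * inner ℝ b c := by
  simp [inner_eq]; ring

lemma inner_self_sphere (x : S2) : inner ℝ (x : E3) x = 1 := by
  rw [real_inner_self_eq_norm_sq, norm_eq_of_mem_sphere x, one_pow]

instance finrankE3 : Fact (Module.finrank ℝ E3 = 2 + 1) := ⟨by simp⟩

/-! ### Tangent vectors in ambient coordinates -/

variable {F₁ F₂ F₃ : Type*} [NormedAddCommGroup F₁] [NormedSpace ℝ F₁]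
  [NormedAddCommGroup F₂] [NormedSpace ℝ F₂] [NormedAddCommGroup F₃] [NormedSpace ℝ F₃]

lemma mvfderiv_bilinear (B : F₁ →L[ℝ] F₂ →L[ℝ] F₃) {f : S2R → F₁} {g : S2R → F₂} {p : S2R}
    (hf : MDifferentiableAt IS2R 𝓘(ℝ, F₁) f p) (hg : MDifferentiableAt IS2R 𝓘(ℝ, F₂) g p)
    (u : TangentSpace IS2R p) :
    mvfderiv IS2R (fun q => B (f q) (g q)) p u =
      B (f p) (mvfderiv IS2R g p u) + B (mvfderiv IS2R f p u) (g p) := by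
  have h1 : HasMFDerivAt IS2R 𝓘(ℝ, F₁ × F₂) (fun q => (f q, g q)) p _ :=
    ⟨hf.hasMFDerivAt.1.prodMk hg.hasMFDerivAt.1, hf.hasMFDerivAt.2.prodMk hg.hasMFDerivAt.2⟩
  have h2 := (B.isBoundedBilinearMap.hasFDerivAt (f p, g p)).hasMFDerivAt
  have h3 := (HasMFDerivAt.comp p h2 h1).mfderiv
  exact congrArg (fun L : ModelE →L[ℝ] F₃ => L u) h3

lemma mvfderiv_linear (B : F₁ →L[ℝ] F₂) {f : S2R → F₁} {p : S2R}
    (hf : MDifferentiableAt IS2R 𝓘(ℝ, F₁) f p)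
    (u : TangentSpace IS2R p) :
    mvfderiv IS2R (fun q => B (f q)) p u = B (mvfderiv IS2R f p u) := by
  have h2 := (B.hasFDerivAt (x := f p)).hasMFDerivAt
  have h3 := (HasMFDerivAt.comp p h2 hf.hasMFDerivAt).mfderiv
  exact congrArg (fun L : ModelE →L[ℝ] F₂ => L u) h3

lemma mdiff_bilinear (B : F₁ →L[ℝ] F₂ →L[ℝ] F₃) {f : S2R → F₁} {g : S2R → F₂} {p : S2R}
    (hf : MDifferentiableAt IS2R 𝓘(ℝ, F₁) f p) (hg : MDifferentiableAt IS2R 𝓘(ℝ, F₂) g p) :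
    MDifferentiableAt IS2R 𝓘(ℝ, F₃) (fun q => B (f q) (g q)) p :=
  MDifferentiableAt.comp p
    (B.isBoundedBilinearMap.hasFDerivAt (f p, g p)).differentiableAt.mdifferentiableAt
    (hf.prodMk_space hg)

lemma contMDiff_bilinear (B : F₁ →L[ℝ] F₂ →L[ℝ] F₃) {f : S2R → F₁} {g : S2R → F₂}
    (hf : ContMDiff IS2R 𝓘(ℝ, F₁) ∞ f) (hg : ContMDiff IS2R 𝓘(ℝ, F₂) ∞ g) :
    ContMDiff IS2R 𝓘(ℝ, F₃) ∞ (fun q => B (f q) (g q)) :=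
  (B.isBoundedBilinearMap.contDiff.contMDiff).comp (hf.prodMk_space hg)

lemma add_tangential_ne_zero (x : S2) (w : E3) :
    (x : E3) + (w - inner ℝ (x : E3) w • (x : E3)) ≠ 0 := by
  intro h
  have := congrArg (inner ℝ (x : E3)) h
  simp [inner_add_right, inner_sub_right, inner_smul_right] at this

/-- The map `(p, w, s) ↦ ((x + w') / ‖x + w'‖, y + s)`, where `p = (x, y)` and `w'` is the
component of `w` orthogonal to `x`. It is defined on all of `(S² × ℝ) × (ℝ³ × ℝ)`, and its derivative
in `(w, s)` at `0` is the orthogonal projection to the tangent space. -/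
def push (q : S2R × (E3 × ℝ)) : S2R :=
  (⟨(‖(q.1.1 : E3) + (q.2.1 - inner ℝ (q.1.1 : E3) q.2.1 • (q.1.1 : E3))‖)⁻¹ •
    ((q.1.1 : E3) + (q.2.1 - inner ℝ (q.1.1 : E3) q.2.1 • (q.1.1 : E3))), by
    rw [mem_sphere_zero_iff_norm, norm_smul, norm_inv, norm_norm]
    exact inv_mul_cancel₀ (norm_ne_zero_iff.2 (add_tangential_ne_zero q.1.1 q.2.1))⟩,
    q.1.2 + q.2.2)

lemma push_zero (p : S2R) : push (p, 0) = p := by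
  refine Prod.ext (Subtype.ext ?_) ?_
  · simp [push]
  · simp [push]

lemma contMDiff_push : ContMDiff (IS2R.prod 𝓘(ℝ, E3 × ℝ)) IS2R ∞ push := by
  have hx : ContMDiff (IS2R.prod 𝓘(ℝ, E3 × ℝ)) 𝓘(ℝ, E3) ∞
      (fun q : S2R × (E3 × ℝ) => (q.1.1 : E3)) :=
    (contMDiff_incl.of_le le_top).comp contMDiff_fst
  have hw : ContMDiff (IS2R.prod 𝓘(ℝ, E3 × ℝ)) 𝓘(ℝ, E3) ∞
      (fun q : S2R × (E3 × ℝ) => q.2.1) :=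
    (contDiff_fst.contMDiff).comp contMDiff_snd
  have hs : ContMDiff (IS2R.prod 𝓘(ℝ, E3 × ℝ)) 𝓘(ℝ, ℝ) ∞
      (fun q : S2R × (E3 × ℝ) => q.2.2) :=
    (contDiff_snd.contMDiff).comp contMDiff_snd
  have hy : ContMDiff (IS2R.prod 𝓘(ℝ, E3 × ℝ)) 𝓘(ℝ, ℝ) ∞
      (fun q : S2R × (E3 × ℝ) => q.1.2) := contMDiff_snd.comp contMDiff_fst
  refine ContMDiff.prodMk ?_ (hy.add hs)
  have h : ContMDiff (IS2R.prod 𝓘(ℝ, E3 × ℝ)) 𝓘(ℝ, E3) ∞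
      (fun q : S2R × (E3 × ℝ) => (((push q).1 : E3))) := by
    intro q
    have h1 : ContDiffAt ℝ ∞ (fun z : E3 × E3 =>
        (‖z.1 + (z.2 - inner ℝ z.1 z.2 • z.1)‖)⁻¹ • (z.1 + (z.2 - inner ℝ z.1 z.2 • z.1)))
        ((q.1.1 : E3), q.2.1) := by
      have h2 : ContDiffAt ℝ ∞ (fun z : E3 × E3 => z.1 + (z.2 - inner ℝ z.1 z.2 • z.1))
        ((q.1.1 : E3), q.2.1) :=
        contDiffAt_fst.add (contDiffAt_snd.sub ((contDiffAt_fst.inner ℝ contDiffAt_snd).smul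
          contDiffAt_fst))
      refine ContDiffAt.smul (ContDiffAt.inv (h2.norm ℝ (add_tangential_ne_zero q.1.1 q.2.1)) ?_) h2
      exact norm_ne_zero_iff.2 (add_tangential_ne_zero q.1.1 q.2.1)
    exact h1.contMDiffAt.comp (f := fun q : S2R × (E3 × ℝ) => ((q.1.1 : E3), q.2.1)) q
      ((hx q).prodMk_space (hw q))
  exact h.codRestrict_sphere (n := 2) _

/-- The vector tangent to `S² × ℝ` at `p = (x, y)` which is the orthogonal projection of
`(w, s) ∈ ℝ³ × ℝ`. -/
def lift (p : S2R) : E3 × ℝ →L[ℝ] TangentSpace IS2R p :=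
  (mfderiv (IS2R.prod 𝓘(ℝ, E3 × ℝ)) IS2R push (p, 0) : ModelE × (E3 × ℝ) →L[ℝ] ModelE).comp
    (ContinuousLinearMap.inr ℝ ModelE (E3 × ℝ))

lemma isSmoothField_lift {ξ : S2R → E3 × ℝ} (hξ : ContMDiff IS2R 𝓘(ℝ, E3 × ℝ) ∞ ξ) :
    IsSmoothField (fun p => lift p (ξ p)) := by
  have h1 : ContMDiff IS2R (𝓘(ℝ, E3 × ℝ).prod 𝓘(ℝ, E3 × ℝ)) ∞
      (fun p => (⟨0, ξ p⟩ : TangentBundle 𝓘(ℝ, E3 × ℝ) (E3 × ℝ))) := by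
    intro p
    rw [Bundle.contMDiffAt_totalSpace]
    refine ⟨contMDiffAt_const, ?_⟩
    simpa using hξ p
  have h0 : ContMDiff IS2R IS2R.tangent ∞
      (fun p => (⟨p, 0⟩ : TangentBundle IS2R S2R)) :=
    Bundle.contMDiff_zeroSection ℝ (TangentSpace IS2R : S2R → Type _)
  have h2 := (contMDiff_push.contMDiff_tangentMap (m := ∞) (by simp)).comp
    (contMDiff_equivTangentBundleProd_symm.comp (h0.prodMk h1))
  refine h2.congr fun p => ?_
  exact Bundle.TotalSpace.ext (push_zero p).symm (heq_of_eq rfl)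

lemma mdiff_incl (p : S2R) : MDifferentiableAt IS2R 𝓘(ℝ, E3) (fun q : S2R => (q.1 : E3)) p :=
  contMDiff_incl.mdifferentiableAt (by simp)

lemma mdiff_y (p : S2R) : MDifferentiableAt IS2R 𝓘(ℝ, ℝ) (fun q : S2R => q.2) p :=
  mdifferentiableAt_snd

lemma inner_dx (p : S2R) (u : TangentSpace IS2R p) : inner ℝ (p.1 : E3) (dx p u) = 0 := by
  have h := mvfderiv_bilinear (innerSL ℝ : E3 →L[ℝ] E3 →L[ℝ] ℝ) (mdiff_incl p) (mdiff_incl p) u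
  have h2 : (fun q : S2R => (innerSL ℝ : E3 →L[ℝ] E3 →L[ℝ] ℝ) (q.1 : E3) (q.1 : E3)) =
      fun _ => (1 : ℝ) := funext fun q => inner_self_sphere q.1
  rw [h2, mvfderiv_const] at h
  change (0 : ℝ) = inner ℝ (p.1 : E3) (dx p u) + inner ℝ (dx p u) (p.1 : E3) at h
  rw [real_inner_comm (p.1 : E3)] at h
  linarith

lemma tangent_ext {p : S2R} {u v : TangentSpace IS2R p} (h1 : dx p u = dx p v)
    (h2 : dy p u = dy p v) : u = v := by
  rw [← sub_eq_zero]
  exact eq_zero_of_dx_dy p _ (by rw [map_sub, h1, sub_self]) (by rw [map_sub, h2, sub_self])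

lemma hasDerivAt_comp_curve {γ : ℝ → S2R} {t : ℝ} {L : ℝ →L[ℝ] ModelE}
    (hγ : HasMFDerivAt 𝓘(ℝ, ℝ) IS2R γ t L) {f : S2R → F₁}
    (hf : MDifferentiableAt IS2R 𝓘(ℝ, F₁) f (γ t)) :
    HasDerivAt (fun s => f (γ s)) (mvfderiv IS2R f (γ t) (L 1 : ModelE)) t := by
  let D : ModelE →L[ℝ] F₁ := mvfderiv IS2R f (γ t)
  have h : HasFDerivAt (fun s => f (γ s)) (D.comp L) t :=
    (hf.hasMFDerivAt.comp t hγ).hasFDerivAt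
  exact h.hasDerivAt

/-- The velocity at `p` of the curve `t ↦ push (p, t w)`. -/
lemma hasMFDerivAt_push_line (p : S2R) (w : E3 × ℝ) :
    HasMFDerivAt 𝓘(ℝ, ℝ) IS2R (fun t : ℝ => push (p, t • w)) 0
      (ContinuousLinearMap.toSpanSingleton ℝ (lift p w : ModelE) : ℝ →L[ℝ] ModelE) := by
  have h1 : HasMFDerivAt (IS2R.prod 𝓘(ℝ, E3 × ℝ)) IS2R push (p, (0 : ℝ) • w) _ :=
    (contMDiff_push.mdifferentiableAt (by simp)).hasMFDerivAt
  have h2 : HasMFDerivAt 𝓘(ℝ, ℝ) 𝓘(ℝ, E3 × ℝ) (fun t : ℝ => t • w) 0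
      (ContinuousLinearMap.toSpanSingleton ℝ w) :=
    (ContinuousLinearMap.toSpanSingleton ℝ w).hasMFDerivAt
  have h3 := HasMFDerivAt.comp (0 : ℝ) h1 ((hasMFDerivAt_const p (0 : ℝ)).prodMk h2)
  refine h3.congr_mfderiv ?_
  refine ContinuousLinearMap.ext fun (t : ℝ) => ?_
  have key : ∀ z : E3 × ℝ, z = 0 →
      (mfderiv (IS2R.prod 𝓘(ℝ, E3 × ℝ)) IS2R push (p, z) : ModelE × (E3 × ℝ) →L[ℝ] ModelE)
        ((0 : ModelE), t • w) = t • (lift p w : ModelE) := by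
    rintro _ rfl
    refine Eq.trans ?_ (map_smul (mfderiv (IS2R.prod 𝓘(ℝ, E3 × ℝ)) IS2R push (p, 0) :
      ModelE × (E3 × ℝ) →L[ℝ] ModelE) t ((0 : ModelE), w))
    congr 1
    exact Prod.ext (smul_zero t).symm rfl
  exact key _ (zero_smul ℝ w)

lemma dx_lift (p : S2R) (w : E3 × ℝ) :
    dx p (lift p w) = w.1 - inner ℝ (p.1 : E3) w.1 • (p.1 : E3) := by
  have h0 : push (p, (0 : ℝ) • w) = p := by rw [zero_smul, push_zero]
  set v : E3 := w.1 - inner ℝ (p.1 : E3) w.1 • (p.1 : E3) with hv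
  have hxv : inner ℝ (p.1 : E3) v = 0 := by
    simp [hv, inner_sub_right, inner_smul_right]
  have h1 : HasDerivAt (fun t : ℝ => ((push (p, t • w)).1 : E3)) (dx p (lift p w)) 0 := by
    have h2 := hasDerivAt_comp_curve (hasMFDerivAt_push_line p w) (mdiff_incl _)
    have h3 : ∀ q : S2R, q = p → (dx q : ModelE →L[ℝ] E3) ((1 : ℝ) • (lift p w : ModelE)) =
        dx p (lift p w) := by
      rintro _ rfl
      rw [one_smul]
    rw [← h3 _ h0]
    exact h2
  have h2 : (fun t : ℝ => ((push (p, t • w)).1 : E3)) =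
      fun t => (√(1 + t ^ 2 * inner ℝ v v))⁻¹ • ((p.1 : E3) + t • v) := by
    funext t
    have h3 : t • w.1 - inner ℝ (p.1 : E3) (t • w.1) • (p.1 : E3) = t • v := by
      rw [hv, inner_smul_right, smul_sub, smul_smul]
    have h4 : ‖(p.1 : E3) + t • v‖ = √(1 + t ^ 2 * inner ℝ v v) := by
      rw [norm_eq_sqrt_real_inner]
      congr 1
      simp only [inner_add_left, inner_add_right, inner_smul_left, inner_smul_right,
        inner_self_sphere, hxv, real_inner_comm (p.1 : E3) v]
      simp
      ring
    rw [← h4, ← h3]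
    rfl
  rw [h2] at h1
  have h5 : HasDerivAt (fun t : ℝ => (√(1 + t ^ 2 * inner ℝ v v))⁻¹) 0 0 := by
    have h6 : HasDerivAt (fun t : ℝ => 1 + t ^ 2 * inner ℝ v v) 0 0 := by
      simpa using (((hasDerivAt_id (0 : ℝ)).pow 2).mul_const (inner ℝ v v)).const_add 1
    simpa using! (h6.sqrt (by simp)).inv (by simp)
  have h7 : HasDerivAt (fun t : ℝ => (p.1 : E3) + t • v) v 0 := by
    simpa using ((hasDerivAt_id (0 : ℝ)).smul_const v).const_add (p.1 : E3)
  have h8 := h5.smul h7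
  refine (h1.unique h8).trans ?_
  simp

lemma dy_lift (p : S2R) (w : E3 × ℝ) : dy p (lift p w) = w.2 := by
  have h0 : push (p, (0 : ℝ) • w) = p := by rw [zero_smul, push_zero]
  have h1 : HasDerivAt (fun t : ℝ => (push (p, t • w)).2) (dy p (lift p w)) 0 := by
    have h2 := hasDerivAt_comp_curve (hasMFDerivAt_push_line p w) (mdiff_y _)
    have h3 : ∀ q : S2R, q = p → (dy q : ModelE →L[ℝ] ℝ) ((1 : ℝ) • (lift p w : ModelE)) =
        dy p (lift p w) := by
      rintro _ rfl
      rw [one_smul]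
    rw [← h3 _ h0]
    exact h2
  have h2 : HasDerivAt (fun t : ℝ => (push (p, t • w)).2) w.2 0 := by
    change HasDerivAt (fun t : ℝ => p.2 + t * w.2) w.2 0
    simpa using ((hasDerivAt_id (0 : ℝ)).mul_const w.2).const_add p.2
  exact h1.unique h2

lemma lift_dx_dy (p : S2R) (u : TangentSpace IS2R p) : lift p (dx p u, dy p u) = u :=
  tangent_ext (by simp [dx_lift, inner_dx]) (by simp [dy_lift])

lemma mdiff_dx {X : VField IS2R S2R} {p : S2R} (hX : MDifferentiableAt IS2R IS2R.tangent
    (fun p => (⟨p, X p⟩ : TangentBundle IS2R S2R)) p) :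
    MDifferentiableAt IS2R 𝓘(ℝ, E3) (fun q => dx q (X q)) p := by
  have h := (contMDiff_incl.contMDiff_tangentMap (m := 1) (by simp)).mdifferentiableAt
    (x := (⟨p, X p⟩ : TangentBundle IS2R S2R)) (by simp)
  have h2 := ((contMDiff_snd_tangentBundle_modelSpace (n := 1) E3 𝓘(ℝ, E3)).mdifferentiableAt
    (by simp)).comp p (h.comp p hX)
  exact h2

lemma mdiff_dy {X : VField IS2R S2R} {p : S2R} (hX : MDifferentiableAt IS2R IS2R.tangent
    (fun p => (⟨p, X p⟩ : TangentBundle IS2R S2R)) p) :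
    MDifferentiableAt IS2R 𝓘(ℝ, ℝ) (fun q => dy q (X q)) p := by
  have h := (contMDiff_snd (n := ω) (I := 𝓡 2) (J := 𝓘(ℝ, ℝ)) (M := S2) (N := ℝ)
    |>.contMDiff_tangentMap (m := 1) (by simp)).mdifferentiableAt
    (x := (⟨p, X p⟩ : TangentBundle IS2R S2R)) (by simp)
  have h2 := ((contMDiff_snd_tangentBundle_modelSpace (n := 1) ℝ 𝓘(ℝ, ℝ)).mdifferentiableAt
    (by simp)).comp p (h.comp p hX)
  exact h2

lemma IsSmoothField.dx {X : VField IS2R S2R} (hX : IsSmoothField X) :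
    ContMDiff IS2R 𝓘(ℝ, E3) ∞ (fun q => dx q (X q)) :=
  (contMDiff_snd_tangentBundle_modelSpace (n := ∞) E3 𝓘(ℝ, E3)).comp
    ((contMDiff_incl.contMDiff_tangentMap (m := ∞) (by simp)).comp hX)

lemma IsSmoothField.dy {X : VField IS2R S2R} (hX : IsSmoothField X) :
    ContMDiff IS2R 𝓘(ℝ, ℝ) ∞ (fun q => dy q (X q)) :=
  (contMDiff_snd_tangentBundle_modelSpace (n := ∞) ℝ 𝓘(ℝ, ℝ)).comp
    (((contMDiff_snd (n := ω) (I := 𝓡 2) (J := 𝓘(ℝ, ℝ)) (M := S2) (N := ℝ)).contMDiff_tangentMap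
      (m := ∞) (by simp)).comp hX)

lemma IsSmoothField.mdiff {X : VField IS2R S2R} (hX : IsSmoothField X) (p : S2R) :
    MDifferentiableAt IS2R IS2R.tangent (fun p => (⟨p, X p⟩ : TangentBundle IS2R S2R)) p :=
  ContMDiff.mdifferentiableAt hX (by simp)

lemma isSmoothField_iff {X : VField IS2R S2R} : IsSmoothField X ↔
    ContMDiff IS2R 𝓘(ℝ, E3) ∞ (fun q => HomogeneousStructures.dx q (X q)) ∧
      ContMDiff IS2R 𝓘(ℝ, ℝ) ∞ (fun q => HomogeneousStructures.dy q (X q)) := by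
  refine ⟨fun h => ⟨h.dx, h.dy⟩, fun h => ?_⟩
  have := isSmoothField_lift (h.1.prodMk_space h.2)
  simpa only [lift_dx_dy] using this

/-! ### Vector fields and Lie brackets -/

lemma contMDiff_mvfderiv {f : S2R → F₁} (hf : ContMDiff IS2R 𝓘(ℝ, F₁) ∞ f)
    {X : VField IS2R S2R} (hX : IsSmoothField X) :
    ContMDiff IS2R 𝓘(ℝ, F₁) ∞ (fun q => mvfderiv IS2R f q (X q)) :=
  (contMDiff_snd_tangentBundle_modelSpace (n := ∞) F₁ 𝓘(ℝ, F₁)).comp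
    ((hf.contMDiff_tangentMap (m := ∞) (by simp)).comp hX)

/-- The coordinate vector field `∂_y`. -/
def vert : VField IS2R S2R := fun p => lift p (0, 1)

lemma isSmoothField_vert : IsSmoothField vert := isSmoothField_lift contMDiff_const

lemma dx_vert (p : S2R) : dx p (vert p) = 0 := by simp [vert, dx_lift]

lemma dy_vert (p : S2R) : dy p (vert p) = 1 := by simp [vert, dy_lift]

/-- The vector field on `S² × ℝ` whose value at each point is the tangential part of the constant
vector `w` of `ℝ³ × ℝ`. -/
def constField (w : E3 × ℝ) : VField IS2R S2R := fun p => lift p w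

lemma isSmoothField_constField (w : E3 × ℝ) : IsSmoothField (constField w) :=
  isSmoothField_lift contMDiff_const

lemma constField_self (p : S2R) (u : TangentSpace IS2R p) :
    constField (dx p u, dy p u) p = u := lift_dx_dy p u

open VectorField in
/-- `[X, Y] f = X (Y f) - Y (X f)`, for real-valued functions. It follows from the Jacobi identity
for `X`, `Y` and `f ∂_y`. -/
lemma mvfderiv_mlieBracket_real {f : S2R → ℝ} (hf : ContMDiff IS2R 𝓘(ℝ, ℝ) ∞ f)
    {X Y : VField IS2R S2R} (hX : IsSmoothField X) (hY : IsSmoothField Y) (p : S2R) :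
    mvfderiv IS2R f p (mlieBracket IS2R X Y p) =
      mvfderiv IS2R (fun q => mvfderiv IS2R f q (Y q)) p (X p) -
        mvfderiv IS2R (fun q => mvfderiv IS2R f q (X q)) p (Y p) := by
  set U := vert with hU
  have hUs : IsSmoothField U := isSmoothField_vert
  have hm (g : S2R → ℝ) (hg : ContMDiff IS2R 𝓘(ℝ, ℝ) ∞ g) (q : S2R) :
      MDifferentiableAt IS2R 𝓘(ℝ, ℝ) g q := hg.mdifferentiableAt (by simp)
  have hbr {V W : VField IS2R S2R} (hV : IsSmoothField V) (hW : IsSmoothField W) :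
      IsSmoothField (mlieBracket IS2R V W) := fun q =>
    ContMDiffAt.mlieBracket_vectorField (m := ⊤) (n := ⊤) (hV q) (hW q) (by simp)
  have hsmul {g : S2R → ℝ} {V : VField IS2R S2R} (hg : ContMDiff IS2R 𝓘(ℝ, ℝ) ∞ g)
      (hV : IsSmoothField V) : IsSmoothField (g • V) := ContMDiff.smul_section hg hV
  have prod {g : S2R → ℝ} {V W : VField IS2R S2R} (hg : ContMDiff IS2R 𝓘(ℝ, ℝ) ∞ g)
      (hW : IsSmoothField W) : mlieBracket IS2R V (g • W) =
        (fun q => mvfderiv IS2R g q (V q)) • W + g • mlieBracket IS2R V W := by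
    funext q
    exact mlieBracket_smul_right (V := V) (hm g hg q) (hW.mdiff q)
  have h2 : minSmoothness ℝ 2 ≤ ∞ := by
    rw [minSmoothness_of_isRCLikeNormedField]
    exact WithTop.coe_le_coe.2 le_top
  have hJ := leibniz_identity_mlieBracket_apply (I := IS2R) (x := p) (U := X) (V := Y) (W := f • U)
    ((hX p).of_le h2) ((hY p).of_le h2) ((hsmul hf hUs p).of_le h2)
  have hJ2 := leibniz_identity_mlieBracket_apply (I := IS2R) (x := p) (U := X) (V := Y) (W := U)
    ((hX p).of_le h2) ((hY p).of_le h2) ((hUs p).of_le h2)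
  have hXf := contMDiff_mvfderiv hf hX
  have hYf := contMDiff_mvfderiv hf hY
  have e1 : mlieBracket IS2R X (mlieBracket IS2R Y (f • U)) p =
      mvfderiv IS2R (fun q => mvfderiv IS2R f q (Y q)) p (X p) • U p +
        mvfderiv IS2R f p (Y p) • mlieBracket IS2R X U p +
        (mvfderiv IS2R f p (X p) • mlieBracket IS2R Y U p +
        f p • mlieBracket IS2R X (mlieBracket IS2R Y U) p) := by
    rw [prod hf hUs, mlieBracket_add_right ((hsmul hYf hUs).mdiff p)
      ((hsmul hf (hbr hY hUs)).mdiff p), prod hYf hUs, prod hf (hbr hY hUs)]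
    rfl
  have e2 : mlieBracket IS2R Y (mlieBracket IS2R X (f • U)) p =
      mvfderiv IS2R (fun q => mvfderiv IS2R f q (X q)) p (Y p) • U p +
        mvfderiv IS2R f p (X p) • mlieBracket IS2R Y U p +
        (mvfderiv IS2R f p (Y p) • mlieBracket IS2R X U p +
        f p • mlieBracket IS2R Y (mlieBracket IS2R X U) p) := by
    rw [prod hf hUs, mlieBracket_add_right ((hsmul hXf hUs).mdiff p)
      ((hsmul hf (hbr hX hUs)).mdiff p), prod hXf hUs, prod hf (hbr hX hUs)]
    rfl
  have e3 : mlieBracket IS2R (mlieBracket IS2R X Y) (f • U) p =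
      mvfderiv IS2R f p (mlieBracket IS2R X Y p) • U p +
        f p • mlieBracket IS2R (mlieBracket IS2R X Y) U p := by
    rw [prod hf hUs]
    rfl
  rw [e1, e2, e3] at hJ
  replace hJ := congrArg (dy p) hJ
  replace hJ2 := congrArg (dy p) hJ2
  simp only [map_add, map_smul, smul_eq_mul, hU, dy_vert] at hJ hJ2
  linear_combination f p * hJ2 - hJ

/-- `[X, Y] f = X (Y f) - Y (X f)`, for `ℝ³`-valued functions. -/
lemma mvfderiv_mlieBracket {f : S2R → E3} (hf : ContMDiff IS2R 𝓘(ℝ, E3) ∞ f)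
    {X Y : VField IS2R S2R} (hX : IsSmoothField X) (hY : IsSmoothField Y) (p : S2R) :
    mvfderiv IS2R f p (VectorField.mlieBracket IS2R X Y p) =
      mvfderiv IS2R (fun q => mvfderiv IS2R f q (Y q)) p (X p) -
        mvfderiv IS2R (fun q => mvfderiv IS2R f q (X q)) p (Y p) := by
  ext i
  let B : E3 →L[ℝ] ℝ := EuclideanSpace.proj i
  have hc (g : S2R → E3) (hg : ContMDiff IS2R 𝓘(ℝ, E3) ∞ g) (q : S2R) (u : TangentSpace IS2R q) :
      mvfderiv IS2R g q u i = mvfderiv IS2R (fun q => g q i) q u :=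
    (mvfderiv_linear B (hg.mdifferentiableAt (by simp)) u).symm
  have hfi : ContMDiff IS2R 𝓘(ℝ, ℝ) ∞ (fun q => f q i) := B.contDiff.contMDiff.comp hf
  rw [PiLp.sub_apply, hc f hf, hc _ (contMDiff_mvfderiv hf hX), hc _ (contMDiff_mvfderiv hf hY),
    mvfderiv_mlieBracket_real hfi hX hY]
  simp only [hc f hf]

/-! ### The Levi-Civita connection -/

lemma isMetricConnection_iff (D : AffineConnection IS2R S2R) : IsMetricConnection metric D ↔
    ∀ (p : S2R) (u : TangentSpace IS2R p) (X Y : VField IS2R S2R),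
      MDifferentiableAt IS2R IS2R.tangent (fun p => (⟨p, X p⟩ : TangentBundle IS2R S2R)) p →
      MDifferentiableAt IS2R IS2R.tangent (fun p => (⟨p, Y p⟩ : TangentBundle IS2R S2R)) p →
      mvfderiv IS2R (fun q => gInner q (X q) (Y q)) p u =
        gInner p (D X p u) (Y p) + gInner p (X p) (D Y p u) := by
  let _ : Bundle.RiemannianBundle (fun x : S2R => TangentSpace IS2R x) :=
    ⟨metric.toRiemannianMetric⟩
  constructor
  · intro h p u X Y hX hY
    have := CovariantDerivative.IsMetricCompatible.mvfderiv_inner_eq h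
      (fun q => lift q (dx p u, dy p u)) hX hY
    simp only [lift_dx_dy] at this
    exact this
  · intro h
    refine (CovariantDerivative.isMetricCompatible_iff _).2 ?_
    intro p Z X Y _ hX hY
    exact h p (Z p) X Y hX hY

/-- The Levi-Civita connection of `S² × ℝ`: the derivative in `ℝ³ × ℝ` followed by the orthogonal
projection to the tangent space. -/
def leviCivita : AffineConnection IS2R S2R where
  toFun Y p := (lift p).comp ((mvfderiv IS2R (fun q => dx q (Y q)) p).prod
    (mvfderiv IS2R (fun q => dy q (Y q)) p))
  isCovariantDerivativeOnUniv := by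
    constructor
    · intro X Y p hX hY _
      refine ContinuousLinearMap.ext fun u => ?_
      have h1 : (fun q => dx q ((X + Y) q)) = fun q => dx q (X q) + dx q (Y q) :=
        funext fun q => map_add (dx q) _ _
      have h2 : (fun q => dy q ((X + Y) q)) = fun q => dy q (X q) + dy q (Y q) :=
        funext fun q => map_add (dy q) _ _
      rw [h1, h2, mvfderiv_fun_add (mdiff_dx hX) (mdiff_dx hY),
        mvfderiv_fun_add (mdiff_dy hX) (mdiff_dy hY)]
      exact map_add (lift p) (mvfderiv IS2R (fun q => dx q (X q)) p u,
        mvfderiv IS2R (fun q => dy q (X q)) p u) (mvfderiv IS2R (fun q => dx q (Y q)) p u,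
        mvfderiv IS2R (fun q => dy q (Y q)) p u)
    · intro X f p hX hf _
      refine ContinuousLinearMap.ext fun u => ?_
      have h1 : (fun q => dx q ((f • X) q)) = fun q => f q • dx q (X q) :=
        funext fun q => map_smul (dx q) _ _
      have h2 : (fun q => dy q ((f • X) q)) = fun q => f q • dy q (X q) :=
        funext fun q => map_smul (dy q) _ _
      rw [h1, h2, mvfderiv_fun_smul hf (mdiff_dx hX), mvfderiv_fun_smul hf (mdiff_dy hX)]
      have h3 := lift_dx_dy p (X p)
      change lift p (f p • mvfderiv IS2R (fun q => dx q (X q)) p u +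
        mvfderiv IS2R f p u • dx p (X p), f p • mvfderiv IS2R (fun q => dy q (X q)) p u +
        mvfderiv IS2R f p u • dy p (X p)) = f p • lift p (mvfderiv IS2R (fun q => dx q (X q)) p u,
          mvfderiv IS2R (fun q => dy q (X q)) p u) + mvfderiv IS2R f p u • X p
      conv_rhs => rw [← h3]
      exact (map_add (lift p) (f p • (mvfderiv IS2R (fun q => dx q (X q)) p u,
          mvfderiv IS2R (fun q => dy q (X q)) p u))
        (mvfderiv IS2R f p u • (dx p (X p), dy p (X p)))).trans
        (congrArg₂ (· + ·) (map_smul _ _ _) (map_smul _ _ _))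

lemma inner_mvfderiv_dx {X : VField IS2R S2R} {p : S2R} (hX : MDifferentiableAt IS2R IS2R.tangent
    (fun p => (⟨p, X p⟩ : TangentBundle IS2R S2R)) p) (u : TangentSpace IS2R p) :
    inner ℝ (p.1 : E3) (mvfderiv IS2R (fun q => dx q (X q)) p u) =
      -inner ℝ (dx p u) (dx p (X p)) := by
  have h := mvfderiv_bilinear (innerSL ℝ : E3 →L[ℝ] E3 →L[ℝ] ℝ) (mdiff_incl p) (mdiff_dx hX) u
  have h2 : (fun q : S2R => (innerSL ℝ : E3 →L[ℝ] E3 →L[ℝ] ℝ) (q.1 : E3) (dx q (X q))) =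
      fun _ => (0 : ℝ) := funext fun q => inner_dx q _
  rw [h2, mvfderiv_const] at h
  change (0 : ℝ) = inner ℝ (p.1 : E3) _ + inner ℝ (dx p u) (dx p (X p)) at h
  linarith

/-- The Gauss formula: the normal component of the ambient derivative is removed. -/
lemma dx_leviCivita {X : VField IS2R S2R} {p : S2R} (hX : MDifferentiableAt IS2R IS2R.tangent
    (fun p => (⟨p, X p⟩ : TangentBundle IS2R S2R)) p) (u : TangentSpace IS2R p) :
    dx p (leviCivita X p u) = mvfderiv IS2R (fun q => dx q (X q)) p u +
      inner ℝ (dx p u) (dx p (X p)) • (p.1 : E3) := by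
  refine (dx_lift p _).trans ?_
  change mvfderiv IS2R (fun q => dx q (X q)) p u -
    inner ℝ (p.1 : E3) (mvfderiv IS2R (fun q => dx q (X q)) p u) • (p.1 : E3) = _
  rw [inner_mvfderiv_dx hX, neg_smul, sub_neg_eq_add]

lemma dy_leviCivita (X : VField IS2R S2R) (p : S2R) (u : TangentSpace IS2R p) :
    dy p (leviCivita X p u) = mvfderiv IS2R (fun q => dy q (X q)) p u :=
  dy_lift p _

lemma mvfderiv_gInner {X Y : VField IS2R S2R} {p : S2R} (hX : MDifferentiableAt IS2R IS2R.tangent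
    (fun p => (⟨p, X p⟩ : TangentBundle IS2R S2R)) p) (hY : MDifferentiableAt IS2R IS2R.tangent
    (fun p => (⟨p, Y p⟩ : TangentBundle IS2R S2R)) p) (u : TangentSpace IS2R p) :
    mvfderiv IS2R (fun q => gInner q (X q) (Y q)) p u =
      inner ℝ (mvfderiv IS2R (fun q => dx q (X q)) p u) (dx p (Y p)) +
      inner ℝ (dx p (X p)) (mvfderiv IS2R (fun q => dx q (Y q)) p u) +
      (mvfderiv IS2R (fun q => dy q (X q)) p u * dy p (Y p) +
        dy p (X p) * mvfderiv IS2R (fun q => dy q (Y q)) p u) := by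
  have h1 := mdiff_bilinear (innerSL ℝ : E3 →L[ℝ] E3 →L[ℝ] ℝ) (mdiff_dx hX) (mdiff_dx hY)
  have h2 := mdiff_bilinear (ContinuousLinearMap.mul ℝ ℝ) (mdiff_dy hX) (mdiff_dy hY)
  have h3 := mvfderiv_bilinear (innerSL ℝ : E3 →L[ℝ] E3 →L[ℝ] ℝ) (mdiff_dx hX) (mdiff_dx hY) u
  have h4 := mvfderiv_bilinear (ContinuousLinearMap.mul ℝ ℝ) (mdiff_dy hX) (mdiff_dy hY) u
  have h5 := congrArg (fun L => L u) (mvfderiv_fun_add h1 h2)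
  refine h5.trans ((congrArg₂ (· + ·) h3 h4).trans ?_)
  change inner ℝ (_ : E3) _ + inner ℝ (_ : E3) _ + (dy p (X p) * _ + _ * dy p (Y p)) = _
  ring

lemma isLeviCivita_leviCivita : IsLeviCivita metric leviCivita where
  metric := by
    rw [isMetricConnection_iff]
    intro p u X Y hX hY
    rw [mvfderiv_gInner hX hY, gInner_apply, gInner_apply, dx_leviCivita hX, dx_leviCivita hY,
      dy_leviCivita, dy_leviCivita]
    simp only [inner_add_left, inner_add_right, inner_smul_left, inner_smul_right,
      inner_dx, real_inner_comm (p.1 : E3) (dx p _)]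
    simp
    ring
  torsion_free := by
    funext p
    refine ContinuousLinearMap.ext fun u => ContinuousLinearMap.ext fun v => ?_
    have hX := isSmoothField_constField (dx p u, dy p u)
    have hY := isSmoothField_constField (dx p v, dy p v)
    have h := CovariantDerivative.torsion_apply leviCivita (hX.mdiff p) (hY.mdiff p)
    rw [constField_self, constField_self] at h
    refine h.trans (sub_eq_zero.2 (tangent_ext ?_ ?_))
    · have h1 := mvfderiv_mlieBracket (contMDiff_incl.of_le le_top) hX hY p
      rw [constField_self, constField_self] at h1
      refine Eq.trans ?_ h1.symm
      rw [map_sub, dx_leviCivita (hX.mdiff p), dx_leviCivita (hY.mdiff p), constField_self,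
        constField_self, real_inner_comm (dx p v)]
      exact add_sub_add_right_eq_sub _ _ _
    · have h1 := mvfderiv_mlieBracket_real (contMDiff_snd (I := 𝓡 2) (J := 𝓘(ℝ, ℝ))) hX hY p
      rw [constField_self, constField_self] at h1
      refine Eq.trans ?_ h1.symm
      rw [map_sub, dy_leviCivita, dy_leviCivita]
      rfl

/-- Two torsion-free metric connections agree: their difference is symmetric in one pair of
arguments and skew in another one. -/
lemma eq_leviCivita {D : AffineConnection IS2R S2R} (hD : IsLeviCivita metric D)
    {X : VField IS2R S2R} {p : S2R} (hX : MDifferentiableAt IS2R IS2R.tangent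
      (fun p => (⟨p, X p⟩ : TangentBundle IS2R S2R)) p) : D X p = leviCivita X p := by
  refine ContinuousLinearMap.ext fun u => ?_
  set a : VField IS2R S2R → VField IS2R S2R → VField IS2R S2R → ℝ := fun X Y Z =>
    gInner p (D X p (Y p) - leviCivita X p (Y p)) (Z p) with ha
  have hsymm : ∀ {X Y Z : VField IS2R S2R},
      MDifferentiableAt IS2R IS2R.tangent (fun p => (⟨p, X p⟩ : TangentBundle IS2R S2R)) p →
      MDifferentiableAt IS2R IS2R.tangent (fun p => (⟨p, Y p⟩ : TangentBundle IS2R S2R)) p →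
      a X Y Z = a Y X Z := by
    intro X Y Z hX hY
    have h1 := (CovariantDerivative.torsion_eq_zero_iff _).1 hD.torsion_free hX hY
    have h2 := (CovariantDerivative.torsion_eq_zero_iff _).1
      isLeviCivita_leviCivita.torsion_free hX hY
    have h3 : D X p (Y p) - leviCivita X p (Y p) = D Y p (X p) - leviCivita Y p (X p) := by
      rw [← h2, sub_eq_sub_iff_add_eq_add] at h1
      rw [sub_eq_sub_iff_add_eq_add, add_comm, ← h1, add_comm]
    simp only [ha, h3]
  have hskew : ∀ {X Y Z : VField IS2R S2R},
      MDifferentiableAt IS2R IS2R.tangent (fun p => (⟨p, X p⟩ : TangentBundle IS2R S2R)) p →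
      MDifferentiableAt IS2R IS2R.tangent (fun p => (⟨p, Z p⟩ : TangentBundle IS2R S2R)) p →
      a X Y Z = -a Z Y X := by
    intro X Y Z hX hZ
    have h1 := (isMetricConnection_iff _).1 hD.metric p (Y p) X Z hX hZ
    have h2 := (isMetricConnection_iff _).1 isLeviCivita_leviCivita.metric p (Y p) X Z hX hZ
    have h3 := metric.symm p (X p) (D Z p (Y p))
    have h4 := metric.symm p (X p) (leviCivita Z p (Y p))
    change gInner p _ _ = gInner p _ _ at h3 h4
    simp only [ha, map_sub, sub_apply]
    linarith
  have key : ∀ v : TangentSpace IS2R p,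
      gInner p (D X p u - leviCivita X p u) v = 0 := by
    intro v
    set Y := constField (dx p u, dy p u)
    set Z := constField (dx p v, dy p v)
    have hY := (isSmoothField_constField (dx p u, dy p u)).mdiff p
    have hZ := (isSmoothField_constField (dx p v, dy p v)).mdiff p
    have h : a X Y Z = 0 := by
      have e1 := hsymm (Z := Z) hX hY
      have e2 := hskew (Y := X) hY hZ
      have e3 := hsymm (Z := Y) hZ hX
      have e4 := hskew (Y := Z) hX hY
      have e5 := hsymm (Z := X) hY hZ
      have e6 := hskew (Y := Y) hZ hX
      linarith
    simpa only [ha, Y, Z, constField_self] using h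
  by_contra hne
  exact (gInner_pos p _ (sub_ne_zero.2 hne)).ne' (key _)

/-! ### Curvature -/

lemma IsSmoothField.leviCivita {X Y : VField IS2R S2R} (hX : IsSmoothField X)
    (hY : IsSmoothField Y) : IsSmoothField (covDeriv leviCivita X Y) := by
  rw [isSmoothField_iff]
  have e1 : (fun q => HomogeneousStructures.dx q (covDeriv HomogeneousStructures.leviCivita X Y q))
      = fun q => mvfderiv IS2R (fun q => HomogeneousStructures.dx q (Y q)) q (X q) +
      inner ℝ (HomogeneousStructures.dx q (X q)) (HomogeneousStructures.dx q (Y q)) •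
        (q.1 : E3) := funext fun q => dx_leviCivita (hY.mdiff q) (X q)
  have e2 : (fun q => HomogeneousStructures.dy q (covDeriv HomogeneousStructures.leviCivita X Y q))
      = fun q => mvfderiv IS2R (fun q => HomogeneousStructures.dy q (Y q)) q (X q) :=
      funext fun q => dy_leviCivita Y q (X q)
  rw [e1, e2]
  exact ⟨(contMDiff_mvfderiv hY.dx hX).add
    ((contMDiff_bilinear (innerSL ℝ : E3 →L[ℝ] E3 →L[ℝ] ℝ) hX.dx hY.dx).smul
      (contMDiff_incl.of_le le_top)), contMDiff_mvfderiv hY.dy hX⟩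

lemma covDeriv_eq_leviCivita {D : AffineConnection IS2R S2R} (hD : IsLeviCivita metric D)
    (X : VField IS2R S2R) {Y : VField IS2R S2R} (hY : IsSmoothField Y) :
    covDeriv D X Y = covDeriv leviCivita X Y :=
  funext fun p => congrArg (fun L => L (X p)) (eq_leviCivita hD (hY.mdiff p))

lemma curvature_eq_leviCivita {D : AffineConnection IS2R S2R} (hD : IsLeviCivita metric D)
    {X Y Z : VField IS2R S2R} (hX : IsSmoothField X) (hY : IsSmoothField Y)
    (hZ : IsSmoothField Z) : curvature D X Y Z = curvature leviCivita X Y Z := by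
  rw [curvature, curvature, covDeriv_eq_leviCivita hD _ hZ, covDeriv_eq_leviCivita hD _ hZ,
    covDeriv_eq_leviCivita hD _ hZ, covDeriv_eq_leviCivita hD _ (hX.leviCivita hZ),
    covDeriv_eq_leviCivita hD _ (hY.leviCivita hZ)]

/-- The curvature tensor of `S² × ℝ` at `p`. -/
def curv (p : S2R) (u v w : TangentSpace IS2R p) : TangentSpace IS2R p :=
  lift p (inner ℝ (dx p v) (dx p w) • dx p u - inner ℝ (dx p u) (dx p w) • dx p v, 0)

lemma dx_curv (p : S2R) (u v w : TangentSpace IS2R p) : dx p (curv p u v w) =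
    inner ℝ (dx p v) (dx p w) • dx p u - inner ℝ (dx p u) (dx p w) • dx p v := by
  simp [curv, dx_lift, inner_sub_right, inner_smul_right, inner_dx]

lemma dy_curv (p : S2R) (u v w : TangentSpace IS2R p) : dy p (curv p u v w) = 0 := by
  simp [curv, dy_lift]

lemma curvature_leviCivita {X Y Z : VField IS2R S2R} (hX : IsSmoothField X)
    (hY : IsSmoothField Y) (hZ : IsSmoothField Z) (p : S2R) :
    curvature leviCivita X Y Z p = curv p (X p) (Y p) (Z p) := by
  have hdx (V : VField IS2R S2R) (hV : IsSmoothField V) (u : TangentSpace IS2R p) :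
      mvfderiv IS2R (fun q => dx q (covDeriv leviCivita V Z q)) p u =
        mvfderiv IS2R (fun q => mvfderiv IS2R (fun q => dx q (Z q)) q (V q)) p u +
        ((inner ℝ (mvfderiv IS2R (fun q => dx q (V q)) p u) (dx p (Z p)) +
          inner ℝ (dx p (V p)) (mvfderiv IS2R (fun q => dx q (Z q)) p u)) • (p.1 : E3) +
          inner ℝ (dx p (V p)) (dx p (Z p)) • dx p u) := by
    have e1 : (fun q => dx q (covDeriv leviCivita V Z q)) = fun q =>
        mvfderiv IS2R (fun q => dx q (Z q)) q (V q) +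
        inner ℝ (dx q (V q)) (dx q (Z q)) • (q.1 : E3) :=
      funext fun q => dx_leviCivita (hZ.mdiff q) (V q)
    have h1 := contMDiff_mvfderiv hZ.dx hV
    have h2 := mdiff_bilinear (innerSL ℝ : E3 →L[ℝ] E3 →L[ℝ] ℝ) (mdiff_dx (hV.mdiff p))
      (mdiff_dx (hZ.mdiff p))
    have h3 := mvfderiv_bilinear (innerSL ℝ : E3 →L[ℝ] E3 →L[ℝ] ℝ) (mdiff_dx (hV.mdiff p))
      (mdiff_dx (hZ.mdiff p)) u
    have h4 := mvfderiv_bilinear (ContinuousLinearMap.lsmul ℝ ℝ) h2 (mdiff_incl p) u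
    have h5 := mdiff_bilinear (ContinuousLinearMap.lsmul ℝ ℝ) h2 (mdiff_incl p)
    have h6 := congrArg (fun L => L u)
      (mvfderiv_fun_add (h1.mdifferentiableAt (x := p) (by simp)) h5)
    rw [e1]
    refine h6.trans (congrArg₂ (· + ·) rfl (h4.trans ?_))
    rw [h3]
    change inner ℝ (_ : E3) _ • dx p u + (inner ℝ (_ : E3) _ + inner ℝ (_ : E3) _) • (p.1 : E3) = _
    rw [add_comm, add_comm (inner ℝ (dx p (V p)) _)]
  have hc1 := mvfderiv_mlieBracket hZ.dx hX hY p
  have hc2 := mvfderiv_mlieBracket_real hZ.dy hX hY p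
  have hc3 := mvfderiv_mlieBracket (contMDiff_incl.of_le le_top) hX hY p
  refine tangent_ext ?_ ?_
  · have h1 : dx p (curvature leviCivita X Y Z p) =
        dx p (leviCivita (covDeriv leviCivita Y Z) p (X p)) -
        dx p (leviCivita (covDeriv leviCivita X Z) p (Y p)) -
        dx p (leviCivita Z p (VectorField.mlieBracket IS2R X Y p)) := by
      rw [← map_sub, ← map_sub]; rfl
    have h2 (V : VField IS2R S2R) : dx p (covDeriv leviCivita V Z p) = _ :=
      dx_leviCivita (hZ.mdiff p) (V p)
    rw [h1, dx_leviCivita ((hY.leviCivita hZ).mdiff p), dx_leviCivita ((hX.leviCivita hZ).mdiff p),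
      dx_leviCivita (hZ.mdiff p), hdx Y hY, hdx X hX, hc1, h2, h2, dx_curv]
    change dx p _ = mvfderiv IS2R (fun q => dx q (Y q)) p (X p) -
      mvfderiv IS2R (fun q => dx q (X q)) p (Y p) at hc3
    rw [hc3]
    simp only [inner_sub_left, inner_add_right, inner_smul_right,
      inner_dx, real_inner_comm (p.1 : E3) (dx p _)]
    module
  · have h1 : dy p (curvature leviCivita X Y Z p) =
        dy p (leviCivita (covDeriv leviCivita Y Z) p (X p)) -
        dy p (leviCivita (covDeriv leviCivita X Z) p (Y p)) -
        dy p (leviCivita Z p (VectorField.mlieBracket IS2R X Y p)) := by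
      rw [← map_sub, ← map_sub]; rfl
    have h2 (V : VField IS2R S2R) : (fun q => dy q (covDeriv leviCivita V Z q)) =
        fun q => mvfderiv IS2R (fun q => dy q (Z q)) q (V q) :=
      funext fun q => dy_leviCivita Z q (V q)
    rw [h1, dy_leviCivita, dy_leviCivita, dy_leviCivita, hc2, dy_curv, h2, h2]
    ring

/-! ### The tensors `T^l` -/

lemma areaForm_apply (p : S2R) (u v : TangentSpace IS2R p) :
    areaForm p u v = inner ℝ (cross p.1 (dx p u)) (dx p v) := by
  change Matrix.det (Matrix.of ![(p.1 : E3).ofLp, (dx p u).ofLp, (dx p v).ofLp]) = _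
  rw [Matrix.det_fin_three, inner_eq]
  simp
  ring

lemma gInner_nondegenerate {p : S2R} {u v : TangentSpace IS2R p}
    (h : ∀ w, gInner p u w = gInner p v w) : u = v := by
  by_contra hne
  have := gInner_pos p _ (sub_ne_zero.2 hne)
  rw [map_sub (gInner p) u v, sub_apply, h, sub_self] at this
  exact this.false

lemma tensorT_eq_lift (l : ℝ) (p : S2R) (u v : TangentSpace IS2R p) :
    tensorT l p u v = lift p ((l * dy p u) • cross p.1 (dx p v), 0) := by
  refine gInner_nondegenerate fun w => (inner_tensorT l p u v w).trans ?_
  rw [areaForm_apply, gInner_apply, dx_lift, dy_lift]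
  simp only [inner_smul_right, inner_cross_left, mul_zero, zero_smul, sub_zero, zero_mul, add_zero]
  rw [real_inner_smul_left]
  ring

lemma dx_tensorT (l : ℝ) (p : S2R) (u v : TangentSpace IS2R p) :
    dx p (tensorT l p u v) = (l * dy p u) • cross p.1 (dx p v) := by
  rw [tensorT_eq_lift, dx_lift]
  simp [inner_smul_right, inner_cross_left]

lemma dy_tensorT (l : ℝ) (p : S2R) (u v : TangentSpace IS2R p) :
    dy p (tensorT l p u v) = 0 := by
  rw [tensorT_eq_lift, dy_lift]

/-! ### Pointwise form of the structure equations -/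

/-- `T_u` is skew-symmetric for the metric. -/
def IsSkewTensor (T : Field12 IS2R S2R) : Prop :=
  ∀ (p : S2R) (u v w : TangentSpace IS2R p), gInner p (T p u v) w + gInner p v (T p u w) = 0

/-- `T_u` acts trivially, as a derivation, on the curvature tensor. -/
def PreservesCurv (T : Field12 IS2R S2R) : Prop :=
  ∀ (p : S2R) (w u v z : TangentSpace IS2R p), T p w (curv p u v z) =
    curv p (T p w u) v z + curv p u (T p w v) z + curv p u v (T p w z)

lemma IsSmoothField.sub {X Y : VField IS2R S2R} (hX : IsSmoothField X) (hY : IsSmoothField Y) :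
    IsSmoothField (X - Y) := ContMDiff.sub_section hX hY

lemma IsSmoothField.covDeriv_subTensor {T : Field12 IS2R S2R} (hT : IsSmoothTensor T)
    {X Y : VField IS2R S2R} (hX : IsSmoothField X) (hY : IsSmoothField Y) :
    IsSmoothField (covDeriv (subTensor HomogeneousStructures.leviCivita T) X Y) := by
  have h : covDeriv (subTensor HomogeneousStructures.leviCivita T) X Y =
      covDeriv HomogeneousStructures.leviCivita X Y - fun p => T p (X p) (Y p) :=
    funext fun p => subTensor_apply _ T Y p (X p)
  rw [h]
  exact (hX.leviCivita hY).sub (hT X Y hX hY)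

lemma IsSmoothField.curv {X Y Z : VField IS2R S2R} (hX : IsSmoothField X) (hY : IsSmoothField Y)
    (hZ : IsSmoothField Z) :
    IsSmoothField (fun p => HomogeneousStructures.curv p (X p) (Y p) (Z p)) := by
  have hI {U V : VField IS2R S2R} (hU : IsSmoothField U) (hV : IsSmoothField V) :=
    contMDiff_bilinear (innerSL ℝ : E3 →L[ℝ] E3 →L[ℝ] ℝ) hU.dx hV.dx
  exact isSmoothField_lift ((((hI hY hZ).smul hX.dx).sub ((hI hX hZ).smul hY.dx)).prodMk_space
    contMDiff_const)

/-- `∇ R = 0`. -/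
lemma leviCivita_curv {X Y Z : VField IS2R S2R} (hX : IsSmoothField X) (hY : IsSmoothField Y)
    (hZ : IsSmoothField Z) (p : S2R) (w : TangentSpace IS2R p) :
    leviCivita (fun q => curv q (X q) (Y q) (Z q)) p w =
      curv p (leviCivita X p w) (Y p) (Z p) + curv p (X p) (leviCivita Y p w) (Z p) +
        curv p (X p) (Y p) (leviCivita Z p w) := by
  refine tangent_ext ?_ ?_
  · have hterm {U V Z : VField IS2R S2R} (hU : IsSmoothField U) (hV : IsSmoothField V)
        (hZ : IsSmoothField Z) :
        MDifferentiableAt IS2R 𝓘(ℝ, E3)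
          (fun q => inner ℝ (dx q (V q)) (dx q (Z q)) • dx q (U q)) p ∧
        mvfderiv IS2R (fun q => inner ℝ (dx q (V q)) (dx q (Z q)) • dx q (U q)) p w =
          inner ℝ (dx p (V p)) (dx p (Z p)) • mvfderiv IS2R (fun q => dx q (U q)) p w +
          (inner ℝ (dx p (V p)) (mvfderiv IS2R (fun q => dx q (Z q)) p w) +
            inner ℝ (mvfderiv IS2R (fun q => dx q (V q)) p w) (dx p (Z p))) • dx p (U p) := by
      have h2 := mdiff_bilinear (innerSL ℝ : E3 →L[ℝ] E3 →L[ℝ] ℝ) (mdiff_dx (hV.mdiff p))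
        (mdiff_dx (hZ.mdiff p))
      have h3 := mvfderiv_bilinear (innerSL ℝ : E3 →L[ℝ] E3 →L[ℝ] ℝ) (mdiff_dx (hV.mdiff p))
        (mdiff_dx (hZ.mdiff p)) w
      have h4 := mvfderiv_bilinear (ContinuousLinearMap.lsmul ℝ ℝ) h2 (mdiff_dx (hU.mdiff p)) w
      rw [h3] at h4
      exact ⟨mdiff_bilinear (ContinuousLinearMap.lsmul ℝ ℝ) h2 (mdiff_dx (hU.mdiff p)), h4⟩
    have h1 := hterm hX hY hZ
    have h2 := hterm hY hX hZ
    have h3 := congrArg (fun L => L w) (mvfderiv_fun_sub h1.1 h2.1)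
    rw [dx_leviCivita ((hX.curv hY hZ).mdiff p)]
    simp only [map_add, dx_curv, dx_leviCivita (hX.mdiff p), dx_leviCivita (hY.mdiff p),
      dx_leviCivita (hZ.mdiff p)]
    refine (congrArg (· + _) (h3.trans (congrArg₂ (· - ·) h1.2 h2.2))).trans ?_
    simp only [inner_add_left, inner_add_right, inner_sub_right, inner_smul_left,
      inner_smul_right, inner_dx, real_inner_comm (p.1 : E3) (dx p _)]
    simp only [mul_zero, add_zero]
    module
  · rw [dy_leviCivita]
    simp only [map_add, dy_curv, mvfderiv_const]
    simp

lemma isMetricConnection_subTensor_iff (T : Field12 IS2R S2R) :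
    IsMetricConnection metric (subTensor leviCivita T) ↔ IsSkewTensor T := by
  have h0 := (isMetricConnection_iff _).1 isLeviCivita_leviCivita.metric
  rw [isMetricConnection_iff]
  constructor
  · intro h p u v w
    have hv := isSmoothField_constField (dx p v, dy p v)
    have hw := isSmoothField_constField (dx p w, dy p w)
    have h1 := h p u _ _ (hv.mdiff p) (hw.mdiff p)
    have h2 := h0 p u _ _ (hv.mdiff p) (hw.mdiff p)
    simp only [subTensor_apply, constField_self, map_sub, sub_apply] at h1 h2
    linarith
  · intro h p u X Y hX hY
    have h1 := h p u (X p) (Y p)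
    have h2 := h0 p u X Y hX hY
    simp only [subTensor_apply, map_sub, sub_apply]
    linarith

lemma isParallelCurvature_subTensor_iff {T : Field12 IS2R S2R} (hT : IsSmoothTensor T) :
    IsParallelCurvature (subTensor leviCivita T) leviCivita ↔ PreservesCurv T := by
  have key {W X Y Z : VField IS2R S2R} (hW : IsSmoothField W) (hX : IsSmoothField X)
      (hY : IsSmoothField Y) (hZ : IsSmoothField Z) (p : S2R) :
      (covDeriv (subTensor leviCivita T) W (curvature leviCivita X Y Z) p =
      curvature leviCivita (covDeriv (subTensor leviCivita T) W X) Y Z p +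
        curvature leviCivita X (covDeriv (subTensor leviCivita T) W Y) Z p +
        curvature leviCivita X Y (covDeriv (subTensor leviCivita T) W Z) p) ↔
      T p (W p) (curv p (X p) (Y p) (Z p)) =
        curv p (T p (W p) (X p)) (Y p) (Z p) + curv p (X p) (T p (W p) (Y p)) (Z p) +
          curv p (X p) (Y p) (T p (W p) (Z p)) := by
    have e : curvature leviCivita X Y Z = fun q => curv q (X q) (Y q) (Z q) :=
      funext fun q => curvature_leviCivita hX hY hZ q
    rw [curvature_leviCivita (hW.covDeriv_subTensor hT hX) hY hZ,
      curvature_leviCivita hX (hW.covDeriv_subTensor hT hY) hZ,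
      curvature_leviCivita hX hY (hW.covDeriv_subTensor hT hZ), e]
    simp only [covDeriv, subTensor_apply, leviCivita_curv hX hY hZ]
    have l1 (a b u v : TangentSpace IS2R p) :
        curv p (a - b) u v = curv p a u v - curv p b u v := by
      refine tangent_ext ?_ ?_
      · simp only [dx_curv, map_sub, inner_sub_left]; module
      · simp only [dy_curv, map_sub, sub_self]
    have l2 (a b u v : TangentSpace IS2R p) :
        curv p u (a - b) v = curv p u a v - curv p u b v := by
      refine tangent_ext ?_ ?_
      · simp only [dx_curv, map_sub, inner_sub_left]; module
      · simp only [dy_curv, map_sub, sub_self]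
    have l3 (a b u v : TangentSpace IS2R p) :
        curv p u v (a - b) = curv p u v a - curv p u v b := by
      refine tangent_ext ?_ ?_
      · simp only [dx_curv, map_sub, inner_sub_right]; module
      · simp only [dy_curv, map_sub, sub_self]
    rw [l1, l2, l3, ← sub_eq_zero, ← sub_eq_zero (b := curv p (T p (W p) (X p)) _ _ + _ + _),
      ← neg_eq_zero]
    refine Eq.congr ?_ rfl
    abel
  constructor
  · intro h p w u v z
    have hs (a : TangentSpace IS2R p) := isSmoothField_constField (dx p a, dy p a)
    have := (key (hs w) (hs u) (hs v) (hs z) p).1 (h _ _ _ _ (hs w) (hs u) (hs v) (hs z) p)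
    simpa only [constField_self] using this
  · intro h W X Y Z hW hX hY hZ p
    exact (key hW hX hY hZ p).2 (h p _ _ _ _)

lemma isHomogeneousStructure_iff (T : Field12 IS2R S2R) : IsHomogeneousStructure metric T ↔
    IsSmoothTensor T ∧ IsSkewTensor T ∧ PreservesCurv T ∧
      IsParallelTensor (subTensor leviCivita T) T := by
  constructor
  · rintro ⟨hT, D, hD, h1, h2, h3⟩
    have hsub (W : VField IS2R S2R) {X : VField IS2R S2R} (hX : IsSmoothField X) :
        covDeriv (subTensor D T) W X = covDeriv (subTensor leviCivita T) W X := by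
      funext p
      simp only [covDeriv, subTensor_apply, eq_leviCivita hD (hX.mdiff p)]
    refine ⟨hT, ?_, ?_, ?_⟩
    · rw [← isMetricConnection_subTensor_iff]
      rw [isMetricConnection_iff] at h1 ⊢
      intro p u X Y hX hY
      have := h1 p u X Y hX hY
      simpa only [subTensor_apply, eq_leviCivita hD hX, eq_leviCivita hD hY] using this
    · rw [← isParallelCurvature_subTensor_iff hT]
      intro W X Y Z hW hX hY hZ p
      have h := h2 W X Y Z hW hX hY hZ p
      have hc {X Y Z : VField IS2R S2R} (hX : IsSmoothField X) (hY : IsSmoothField Y)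
          (hZ : IsSmoothField Z) : IsSmoothField (curvature leviCivita X Y Z) := by
        have e : curvature leviCivita X Y Z = fun q => curv q (X q) (Y q) (Z q) :=
          funext fun q => curvature_leviCivita hX hY hZ q
        rw [e]
        exact hX.curv hY hZ
      rw [hsub W hX, hsub W hY, hsub W hZ, curvature_eq_leviCivita hD hX hY hZ,
        curvature_eq_leviCivita hD (hW.covDeriv_subTensor hT hX) hY hZ,
        curvature_eq_leviCivita hD hX (hW.covDeriv_subTensor hT hY) hZ,
        curvature_eq_leviCivita hD hX hY (hW.covDeriv_subTensor hT hZ), hsub W (hc hX hY hZ)] at h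
      exact h
    · intro W X Y hW hX hY p
      have h := h3 W X Y hW hX hY p
      rw [hsub W hX, hsub W hY, hsub W (hT X Y hX hY)] at h
      exact h
  · rintro ⟨hT, h1, h2, h3⟩
    exact ⟨hT, leviCivita, isLeviCivita_leviCivita, (isMetricConnection_subTensor_iff T).2 h1,
      (isParallelCurvature_subTensor_iff hT).2 h2, h3⟩

/-! ### The tensors `T^l` are homogeneous structures -/

/-- The component of a vector orthogonal to the unit vector `x`, as a double cross product. -/
lemma eq_inner_smul_sub_cross (x : S2) (v : E3) :
    v = inner ℝ (x : E3) v • (x : E3) - cross x (cross x v) := by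
  rw [cross_cross, inner_self_sphere]
  module

lemma cross_eq_of_orthogonal (x : S2) {a b : E3} (ha : inner ℝ (x : E3) a = 0)
    (hb : inner ℝ (x : E3) b = 0) :
    cross a b = inner ℝ (x : E3) (cross a b) • (x : E3) := by
  conv_lhs => rw [eq_inner_smul_sub_cross x (cross a b)]
  rw [cross_cross (x : E3) a b, ha, hb]
  simp

lemma isSmoothTensor_tensorT (l : ℝ) : IsSmoothTensor (tensorT l) := by
  intro X Y hX hY
  rw [isSmoothField_iff]
  simp only [dx_tensorT, dy_tensorT]
  exact ⟨(contMDiff_const.mul hX.dy).smul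
    (contMDiff_bilinear cross (contMDiff_incl.of_le le_top) hY.dx), contMDiff_const⟩

lemma isSkewTensor_tensorT (l : ℝ) : IsSkewTensor (tensorT l) := by
  intro p u v w
  simp only [gInner_apply, dx_tensorT, dy_tensorT, real_inner_smul_left, real_inner_smul_right]
  rw [real_inner_comm (dx p w), inner_cross_rotate, inner_cross_rotate, cross_swap (dx p w),
    inner_neg_right]
  ring

lemma preservesCurv_tensorT (l : ℝ) : PreservesCurv (tensorT l) := by
  intro p w u v z
  have hskew (a b : E3) : inner ℝ (cross (p.1 : E3) a) b = -inner ℝ a (cross (p.1 : E3) b) := by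
    simp [inner_eq]; ring
  refine tangent_ext ?_ ?_
  · simp only [map_add, dx_tensorT, dx_curv, map_sub, map_smul, real_inner_smul_left,
      real_inner_smul_right, hskew]
    module
  · simp only [map_add, dy_tensorT, dy_curv, add_zero]

/-- Covariant derivative of a field `φ x × Y`. -/
lemma dx_leviCivita_smul_cross {Y Z : VField IS2R S2R} (hY : IsSmoothField Y)
    (hZ : IsSmoothField Z) {φ : S2R → ℝ} (hφ : ContMDiff IS2R 𝓘(ℝ, ℝ) ∞ φ)
    (h : ∀ q, dx q (Z q) = φ q • cross q.1 (dx q (Y q))) (p : S2R) (w : TangentSpace IS2R p) :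
    dx p (leviCivita Z p w) = mvfderiv IS2R φ p w • cross p.1 (dx p (Y p)) +
      φ p • cross p.1 (dx p (leviCivita Y p w)) := by
  have h1 := mdiff_bilinear cross (mdiff_incl p) (mdiff_dx (hY.mdiff p))
  have h2 := mvfderiv_bilinear (ContinuousLinearMap.lsmul ℝ ℝ)
    (hφ.mdifferentiableAt (x := p) (by simp)) h1 w
  rw [mvfderiv_bilinear cross (mdiff_incl p) (mdiff_dx (hY.mdiff p))] at h2
  have h3 : mvfderiv IS2R (fun q => dx q (Z q)) p w = φ p •
      (cross p.1 (mvfderiv IS2R (fun q => dx q (Y q)) p w) + cross (dx p w) (dx p (Y p))) +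
      mvfderiv IS2R φ p w • cross p.1 (dx p (Y p)) := by
    rw [funext h]
    exact h2
  rw [dx_leviCivita (hZ.mdiff p), dx_leviCivita (hY.mdiff p), h3, h p, map_add, map_smul,
    cross_self, smul_zero, add_zero, cross_eq_of_orthogonal p.1 (inner_dx p w) (inner_dx p (Y p)),
    real_inner_smul_right]
  have e : inner ℝ (p.1 : E3) (cross (dx p w) (dx p (Y p))) =
      -inner ℝ (dx p w) (cross p.1 (dx p (Y p))) := by
    simp [inner_eq]; ring
  rw [e]
  module

lemma isParallelTensor_tensorT (l : ℝ) :
    IsParallelTensor (subTensor leviCivita (tensorT l)) (tensorT l) := by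
  intro W X Y hW hX hY p
  refine tangent_ext ?_ ?_
  · simp only [covDeriv, subTensor_apply, map_sub, map_add]
    have hφ : ContMDiff IS2R 𝓘(ℝ, ℝ) ∞ (fun q => l * dy q (X q)) := contMDiff_const.mul hX.dy
    rw [dx_leviCivita_smul_cross hY (isSmoothTensor_tensorT l X Y hX hY) hφ
      (fun q => dx_tensorT l q _ _)]
    have h1 : mvfderiv IS2R (fun q => l * dy q (X q)) p (W p) =
        l * mvfderiv IS2R (fun q => dy q (X q)) p (W p) :=
      mvfderiv_linear (ContinuousLinearMap.mul ℝ ℝ l) (mdiff_dy (hX.mdiff p)) (W p)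
    simp only [dx_tensorT, dy_tensorT, dy_leviCivita, h1, map_sub, sub_apply, map_smul]
    module
  · simp only [covDeriv, subTensor_apply]
    rw [map_sub (dy p), map_add (dy p), dy_tensorT, dy_tensorT, dy_tensorT, dy_leviCivita]
    simp only [dy_tensorT, mvfderiv_const]
    simp

lemma isHomogeneousStructure_tensorT (l : ℝ) : IsHomogeneousStructure metric (tensorT l) :=
  (isHomogeneousStructure_iff _).2 ⟨isSmoothTensor_tensorT l, isSkewTensor_tensorT l,
    preservesCurv_tensorT l, isParallelTensor_tensorT l⟩

/-! ### The one-form of a homogeneous structure -/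

lemma exists_unit_orthogonal (x : S2) : ∃ w : E3, inner ℝ (x : E3) w = 0 ∧ inner ℝ w w = 1 := by
  have h : 0 < Module.finrank ℝ (ℝ ∙ (x : E3))ᗮ := by
    rw [Submodule.finrank_orthogonal_span_singleton (n := 2) (ne_zero_of_mem_unit_sphere x)]
    norm_num
  have := Module.nontrivial_of_finrank_pos h
  obtain ⟨w, hw⟩ := exists_ne (0 : (ℝ ∙ (x : E3))ᗮ)
  have hw0 : ‖(w : E3)‖ ≠ 0 := by simpa using hw
  have hxw : inner ℝ (x : E3) (w : E3) = 0 :=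
    Submodule.mem_orthogonal_singleton_iff_inner_right.1 w.2
  refine ⟨‖(w : E3)‖⁻¹ • (w : E3), ?_, ?_⟩
  · rw [real_inner_smul_right, hxw, mul_zero]
  · rw [real_inner_smul_right, real_inner_smul_left, real_inner_self_eq_norm_sq]
    field_simp

/-- A function on `S² × ℝ` with zero differential is constant. -/
lemma eq_of_mvfderiv_eq_zero {f : S2R → ℝ} (hf : ContMDiff IS2R 𝓘(ℝ, ℝ) ∞ f)
    (h : ∀ p (u : TangentSpace IS2R p), mvfderiv IS2R f p u = 0) (p q : S2R) : f p = f q := by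
  have hpush (p : S2R) (w : E3 × ℝ) : f (push (p, w)) = f p := by
    have hc : ContMDiff 𝓘(ℝ, E3 × ℝ) IS2R ∞ (fun w : E3 × ℝ => push (p, w)) :=
      contMDiff_push.comp (contMDiff_const.prodMk contMDiff_id)
    have hd : Differentiable ℝ (fun w : E3 × ℝ => f (push (p, w))) :=
      ((hf.comp hc).mdifferentiable (by simp)).differentiable
    have h0 : ∀ w, fderiv ℝ (fun w : E3 × ℝ => f (push (p, w))) w = 0 := by
      intro w
      have h1 := mfderiv_comp w (hf.mdifferentiableAt (x := push (p, w)) (by simp))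
        (hc.mdifferentiableAt (x := w) (by simp))
      rw [mfderiv_eq_fderiv] at h1
      refine ContinuousLinearMap.ext fun v => ?_
      exact (congrArg (fun L : E3 × ℝ →L[ℝ] ℝ => L v) h1).trans (h _ _)
    rw [is_const_of_fderiv_eq_zero hd h0 w 0, push_zero]
  have hloc : IsLocallyConstant f := by
    rw [IsLocallyConstant.iff_exists_open]
    intro p
    refine ⟨{q | 0 < inner ℝ (p.1 : E3) (q.1 : E3)}, isOpen_lt continuous_const
      (continuous_const.inner (continuous_subtype_val.comp continuous_fst)), ?_, fun q hq => ?_⟩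
    · simp
    · have hq' : 0 < inner ℝ (p.1 : E3) (q.1 : E3) := hq
      set c := inner ℝ (p.1 : E3) (q.1 : E3) with hc
      rw [← hpush p (c⁻¹ • (q.1 : E3), q.2 - p.2)]
      congr 1
      have e : (p.1 : E3) + (c⁻¹ • (q.1 : E3) - inner ℝ (p.1 : E3) (c⁻¹ • (q.1 : E3)) • (p.1 : E3))
          = c⁻¹ • (q.1 : E3) := by
        rw [real_inner_smul_right, ← hc, inv_mul_cancel₀ hq'.ne']
        module
      refine Prod.ext (Subtype.ext ?_) ?_
      · change (q.1 : E3) = ‖_‖⁻¹ • _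
        rw [e, norm_smul, norm_eq_of_mem_sphere q.1, Real.norm_of_nonneg (inv_nonneg.2 hq'.le),
          mul_one, inv_inv, smul_smul, mul_inv_cancel₀ hq'.ne', one_smul]
      · change q.2 = p.2 + (q.2 - p.2)
        ring
  have : PreconnectedSpace S2 := Subtype.preconnectedSpace
    (isPreconnected_sphere
      (by rw [rank_eq_card_basis (EuclideanSpace.basisFun (Fin 3) ℝ).toBasis]; simp) _ _)
  exact hloc.apply_eq_of_preconnectedSpace p q

/-- The `i`-th standard basis vector of `ℝ³`. -/
abbrev stdVec (i : Fin 3) : E3 := EuclideanSpace.single i 1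

lemma eq_sum_stdVec (v : E3) : v = ∑ i, v i • stdVec i := by
  ext j
  fin_cases j <;> simp [Fin.sum_univ_three, stdVec]

/-- A skew-symmetric endomorphism of `ℝ³` that vanishes on the unit vector `x` is a multiple of
`v ↦ x × v`. -/
lemma skew_eq_smul_cross (x : S2) (S : E3 →ₗ[ℝ] E3) (hS : ∀ v w, inner ℝ (S v) w = -inner ℝ v (S w))
    (hx : S x = 0) (v : E3) :
    S v = (2⁻¹ * ∑ i, inner ℝ (S (stdVec i)) (cross x (stdVec i))) • cross x v := by
  have hcomp (i j : Fin 3) : S (stdVec i) j = -S (stdVec j) i := by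
    have := hS (stdVec i) (stdVec j)
    simpa [stdVec, EuclideanSpace.inner_single_left, EuclideanSpace.inner_single_right] using this
  obtain ⟨b, hb⟩ : ∃ b : E3, ∀ v, S v = cross b v := by
    refine ⟨!₂[S (stdVec 1) 2, S (stdVec 2) 0, S (stdVec 0) 1], fun v => ?_⟩
    have h00 := hcomp 0 0
    have h11 := hcomp 1 1
    have h22 := hcomp 2 2
    have h01 := hcomp 0 1
    have h12 := hcomp 1 2
    have h20 := hcomp 2 0
    have hv : S v = ∑ i, v i • S (stdVec i) := by
      conv_lhs => rw [eq_sum_stdVec v, map_sum]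
      simp only [map_smul]
    rw [hv]
    ext j
    fin_cases j <;> simp [Fin.sum_univ_three]
    · linear_combination v 0 / 2 * h00 + v 1 * h01
    · linear_combination v 1 / 2 * h11 + v 2 * h12
    · linear_combination v 2 / 2 * h22 + v 0 * h20
  have hbx : b = inner ℝ (x : E3) b • (x : E3) := by
    have h1 := eq_inner_smul_sub_cross x b
    rwa [cross_swap (x : E3) b, ← hb, hx, neg_zero, map_zero, sub_zero] at h1
  set c := inner ℝ (x : E3) b
  have hSc (v : E3) : S v = c • cross x v := by
    rw [hb, hbx, map_smul]
    rfl
  have hsum : ∑ i, inner ℝ (S (stdVec i)) (cross x (stdVec i)) = 2 * c := by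
    have h1 := inner_self_sphere x
    rw [inner_eq] at h1
    simp only [hSc, real_inner_smul_left, Fin.sum_univ_three, inner_eq, stdVec]
    simp
    linear_combination 2 * c * h1
  rw [hsum, hSc, inv_mul_cancel_left₀ two_ne_zero]

/-- The coefficient `ω` in `T_u v = ω(u) x × v`, for a homogeneous structure `T`, written as half of
the trace of the quadratic form `v ↦ ⟨T_u v, x × v⟩` on `ℝ³` so as to be defined, and smooth,
without a choice of `v`. -/
def omega (T : Field12 IS2R S2R) (p : S2R) : TangentSpace IS2R p →ₗ[ℝ] ℝ where
  toFun u := 2⁻¹ * ∑ i, inner ℝ (dx p (T p u (lift p (stdVec i, 0)))) (cross p.1 (stdVec i))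
  map_add' u v := by
    simp only [map_add, add_apply, inner_add_left, Finset.sum_add_distrib, mul_add]
  map_smul' c u := by
    simp only [map_smul, smul_apply, real_inner_smul_left, ← Finset.mul_sum, smul_eq_mul,
      RingHom.id_apply]
    ring

lemma contMDiff_omega {T : Field12 IS2R S2R} (hT : IsSmoothTensor T) {X : VField IS2R S2R}
    (hX : IsSmoothField X) : ContMDiff IS2R 𝓘(ℝ, ℝ) ∞ (fun q => omega T q (X q)) := by
  have h (i : Fin 3) : ContMDiff IS2R 𝓘(ℝ, ℝ) ∞ (fun q : S2R =>
      inner ℝ (dx q (T q (X q) (lift q (stdVec i, 0)))) (cross (q.1 : E3) (stdVec i))) :=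
    contMDiff_bilinear (innerSL ℝ : E3 →L[ℝ] E3 →L[ℝ] ℝ)
      (hT X _ hX (isSmoothField_constField (stdVec i, 0))).dx
      (contMDiff_bilinear cross (contMDiff_incl.of_le le_top) contMDiff_const)
  exact contMDiff_const.mul (contMDiff_finsetSum fun i _ => h i)

/-- `T_u ∂_y = 0`: the field `∂_y` spans the nullity of the curvature, which `T_u` preserves, and
`T_u ∂_y` is orthogonal to `∂_y`. -/
lemma apply_vert {T : Field12 IS2R S2R} (hs : IsSkewTensor T) (hc : PreservesCurv T)
    (p : S2R) (u : TangentSpace IS2R p) : T p u (vert p) = 0 := by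
  refine tangent_ext ?_ ?_
  · rw [map_zero]
    set a := dx p (T p u (vert p)) with ha
    set v := lift p (cross p.1 a, 0) with hv
    have hdv : dx p v = cross p.1 a := by
      simp [hv, dx_lift, inner_cross_left]
    have h0 (b c : TangentSpace IS2R p) : curv p (vert p) b c = 0 := by
      refine tangent_ext ?_ ?_
      · rw [dx_curv, dx_vert]; simp
      · rw [dy_curv, map_zero]
    have h := hc p u (vert p) v v
    rw [h0, h0, h0, map_zero, add_zero, add_zero] at h
    have h1 := congrArg (dx p) h
    rw [map_zero, dx_curv, hdv, ← ha, inner_cross_right, zero_smul, sub_zero, inner_cross_cross,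
      inner_self_sphere, inner_dx] at h1
    have h2 : inner ℝ a a • a = 0 := by simpa using h1.symm
    rcases smul_eq_zero.1 h2 with h3 | h3
    · exact inner_self_eq_zero.1 h3
    · exact h3
  · have h := hs p u (vert p) (vert p)
    rw [gInner_apply, gInner_apply, dx_vert, dy_vert] at h
    simp at h
    rw [map_zero]
    linarith

lemma dy_apply {T : Field12 IS2R S2R} (hs : IsSkewTensor T) (hc : PreservesCurv T)
    (p : S2R) (u v : TangentSpace IS2R p) : dy p (T p u v) = 0 := by
  have h := hs p u v (vert p)
  rw [apply_vert hs hc, map_zero, gInner_apply, dx_vert, dy_vert] at h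
  simpa using h

/-- `T_u v = ω(u) x × v`. -/
lemma dx_apply {T : Field12 IS2R S2R} (hs : IsSkewTensor T) (hc : PreservesCurv T)
    (p : S2R) (u v : TangentSpace IS2R p) :
    dx p (T p u v) = omega T p u • cross p.1 (dx p v) := by
  let ι : E3 →L[ℝ] E3 × ℝ := ContinuousLinearMap.inl ℝ E3 ℝ
  let S : E3 →ₗ[ℝ] E3 := ((dx p).comp ((T p u).comp ((lift p).comp ι))).toLinearMap
  have hS (w : E3) : S w = dx p (T p u (lift p (w, 0))) := rfl
  have hskew (a b : E3) : inner ℝ (S a) b = -inner ℝ a (S b) := by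
    have h := hs p u (lift p (a, 0)) (lift p (b, 0))
    rw [gInner_apply, gInner_apply, ← hS, ← hS, dx_lift, dx_lift, dy_lift, dy_lift,
      inner_sub_right, inner_sub_left, real_inner_smul_left, real_inner_smul_right,
      real_inner_comm (p.1 : E3) (S a)] at h
    rw [hS, hS, inner_dx, inner_dx, ← hS, ← hS] at h
    simp at h
    linarith
  have hSx : S (p.1 : E3) = 0 := by
    have h : lift p ((p.1 : E3), 0) = 0 := by
      refine tangent_ext ?_ ?_
      · rw [dx_lift, inner_self_sphere, one_smul, sub_self, map_zero]
      · rw [dy_lift, map_zero]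
    rw [hS, h, map_zero, map_zero]
  have h := skew_eq_smul_cross p.1 S hskew hSx (dx p v)
  have hv : v = lift p (dx p v, 0) + dy p v • vert p := by
    refine tangent_ext ?_ ?_
    · rw [map_add, map_smul, dx_vert, dx_lift, inner_dx]; simp
    · rw [map_add, map_smul, dy_vert, dy_lift]; simp
  have h2 : dx p (T p u v) = S (dx p v) := by
    conv_lhs => rw [hv]
    rw [map_add, map_smul, apply_vert hs hc, smul_zero, add_zero, hS]
  rw [h2, h]
  rfl

/-- The form `ω` is parallel for `∇ - T`. -/
lemma mvfderiv_omega {T : Field12 IS2R S2R} (hs : IsSkewTensor T) (hc : PreservesCurv T)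
    (hT : IsSmoothTensor T)
    (hp : IsParallelTensor (subTensor leviCivita T) T) {X : VField IS2R S2R}
    (hX : IsSmoothField X) (p : S2R) (w : TangentSpace IS2R p) :
    mvfderiv IS2R (fun q => omega T q (X q)) p w =
      omega T p (leviCivita X p w) - omega T p (T p w (X p)) := by
  obtain ⟨a, ha, ha1⟩ := exists_unit_orthogonal p.1
  have hW := isSmoothField_constField (dx p w, dy p w)
  have hY := isSmoothField_constField (a, 0)
  have h := congrArg (dx p) (hp _ X _ hW hX hY p)
  simp only [covDeriv, subTensor_apply, constField_self] at h
  rw [map_sub (dx p), dx_leviCivita_smul_cross hY (hT X _ hX hY) (contMDiff_omega hT hX)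
    (fun q => dx_apply hs hc q _ _), map_add (dx p), dx_apply hs hc, dx_apply hs hc,
    dx_apply hs hc, dx_apply hs hc, map_sub (omega T p), map_sub (dx p), dx_apply hs hc] at h
  have hb : dx p (constField (a, 0) p) = a := by
    rw [constField, dx_lift, ha, zero_smul, sub_zero]
  rw [hb, map_sub (cross (p.1 : E3)), map_smul] at h
  have h2 : (mvfderiv IS2R (fun q => omega T q (X q)) p w -
      (omega T p (leviCivita X p w) - omega T p (T p w (X p)))) • cross (p.1 : E3) a = 0 := by
    rw [map_smul] at h
    linear_combination (norm := module) h
  have h3 : cross (p.1 : E3) a ≠ 0 := by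
    intro h0
    have := inner_cross_cross (p.1 : E3) a p.1 a
    rw [h0, inner_self_sphere, ha1, ha] at this
    simp at this
  exact sub_eq_zero.1 ((smul_eq_zero.1 h2).resolve_right h3)

/-- `ω(∂_y)` is constant. -/
lemma omega_vert {T : Field12 IS2R S2R} (hs : IsSkewTensor T) (hc : PreservesCurv T)
    (hT : IsSmoothTensor T) (hp : IsParallelTensor (subTensor leviCivita T) T) (p q : S2R) :
    omega T p (vert p) = omega T q (vert q) := by
  refine eq_of_mvfderiv_eq_zero (contMDiff_omega hT isSmoothField_vert) (fun p u => ?_) p q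
  have h : leviCivita vert p u = 0 := by
    refine tangent_ext ?_ ?_
    · rw [dx_leviCivita (isSmoothField_vert.mdiff p)]
      simp [dx_vert, mvfderiv_const]
    · rw [dy_leviCivita]
      simp [dy_vert, mvfderiv_const]
  rw [mvfderiv_omega hs hc hT hp isSmoothField_vert, h, apply_vert hs hc, map_zero, sub_zero]

/-- The vector field dual to the restriction of `ω` to the tangent planes of the sphere. -/
def omegaDual (T : Field12 IS2R S2R) (p : S2R) : E3 :=
  ∑ i, omega T p (lift p (stdVec i, 0)) • stdVec i

lemma omega_lift (T : Field12 IS2R S2R) (p : S2R) (v : E3) :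
    omega T p (lift p (v, 0)) = inner ℝ (omegaDual T p) v := by
  have h : (v, (0 : ℝ)) = ∑ i, v i • (stdVec i, (0 : ℝ)) := by
    refine Prod.ext ?_ ?_
    · conv_lhs => rw [eq_sum_stdVec v]
      simp [Prod.fst_sum]
    · simp [Prod.snd_sum]
  rw [h, map_sum, map_sum, omegaDual, sum_inner]
  refine Finset.sum_congr rfl fun i _ => ?_
  rw [map_smul, map_smul, real_inner_smul_left, EuclideanSpace.inner_single_left]
  simp [mul_comm]

lemma omega_eq (T : Field12 IS2R S2R) (p : S2R) (u : TangentSpace IS2R p) :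
    omega T p u = inner ℝ (omegaDual T p) (dx p u) + dy p u * omega T p (vert p) := by
  rw [← omega_lift, ← smul_eq_mul, ← map_smul, ← map_add]
  congr 1
  refine tangent_ext ?_ ?_
  · rw [map_add, map_smul, dx_vert, dx_lift, inner_dx]; simp
  · rw [map_add, map_smul, dy_vert, dy_lift]; simp

lemma contMDiff_omegaDual {T : Field12 IS2R S2R} (hT : IsSmoothTensor T) :
    ContMDiff IS2R 𝓘(ℝ, E3) ∞ (omegaDual T) :=
  contMDiff_finsetSum fun i _ => (contMDiff_omega hT
    (isSmoothField_constField (stdVec i, 0))).smul contMDiff_const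

lemma inner_omegaDual (T : Field12 IS2R S2R) (p : S2R) :
    inner ℝ (omegaDual T p) (p.1 : E3) = 0 := by
  rw [← omega_lift]
  have h : lift p ((p.1 : E3), 0) = 0 := by
    refine tangent_ext ?_ ?_
    · rw [dx_lift, inner_self_sphere, one_smul, sub_self, map_zero]
    · rw [dy_lift, map_zero]
  rw [h, map_zero]

lemma leviCivita_constField (v : E3) (p : S2R) (w : TangentSpace IS2R p) :
    leviCivita (constField (v, 0)) p w = lift p (-inner ℝ (p.1 : E3) v • dx p w, 0) := by
  have hX := (isSmoothField_constField (v, 0)).mdiff p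
  refine tangent_ext ?_ ?_
  · have h : (fun q => dx q (constField (v, 0) q)) = fun q : S2R =>
        v - inner ℝ (q.1 : E3) v • (q.1 : E3) := funext fun q => dx_lift q (v, 0)
    have h1 := mdiff_bilinear (innerSL ℝ : E3 →L[ℝ] E3 →L[ℝ] ℝ) (mdiff_incl p)
      (mdifferentiableAt_const (c := v))
    have h2 := mvfderiv_bilinear (innerSL ℝ : E3 →L[ℝ] E3 →L[ℝ] ℝ) (mdiff_incl p)
      (mdifferentiableAt_const (c := v)) w
    have h3 := mvfderiv_bilinear (ContinuousLinearMap.lsmul ℝ ℝ) h1 (mdiff_incl p) w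
    have h4 := congrArg (fun L => L w) (mvfderiv_fun_sub (mdifferentiableAt_const (c := v))
      (mdiff_bilinear (ContinuousLinearMap.lsmul ℝ ℝ) h1 (mdiff_incl p)))
    have h5 : mvfderiv IS2R (fun q => dx q (constField (v, 0) q)) p w =
        -(inner ℝ (p.1 : E3) v • dx p w + inner ℝ (dx p w) v • (p.1 : E3)) := by
      rw [h]
      refine h4.trans ?_
      rw [sub_apply, h3, h2, mvfderiv_const]
      simp
      rfl
    rw [dx_leviCivita hX, h5, dx_lift, constField, dx_lift]
    simp only [inner_sub_right, real_inner_smul_right, real_inner_comm (p.1 : E3) (dx p w),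
      inner_dx]
    module
  · rw [dy_leviCivita, dy_lift]
    have h : (fun q => dy q (constField (v, 0) q)) = fun _ => (0 : ℝ) :=
      funext fun q => dy_lift q (v, 0)
    rw [h, mvfderiv_const]
    rfl

/-- The form `ω` being parallel, in terms of its dual vector field. -/
lemma mvfderiv_omegaDual {T : Field12 IS2R S2R} (hs : IsSkewTensor T) (hc : PreservesCurv T)
    (hT : IsSmoothTensor T) (hp : IsParallelTensor (subTensor leviCivita T) T) (p : S2R)
    (w : TangentSpace IS2R p) :
    mvfderiv IS2R (omegaDual T) p w = -inner ℝ (omegaDual T p) (dx p w) • (p.1 : E3) -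
      omega T p w • cross (omegaDual T p) p.1 := by
  refine ext_inner_right ℝ fun v => ?_
  have hA := (contMDiff_omegaDual hT).mdifferentiableAt (x := p) (by simp)
  have h1 := mvfderiv_bilinear (innerSL ℝ : E3 →L[ℝ] E3 →L[ℝ] ℝ) hA
      (mdifferentiableAt_const (c := v)) w
  rw [mvfderiv_const] at h1
  have h2 : (fun q => omega T q (constField (v, 0) q)) = fun q =>
      (innerSL ℝ : E3 →L[ℝ] E3 →L[ℝ] ℝ) (omegaDual T q) v := funext fun q => omega_lift T q v
  rw [← h2, mvfderiv_omega hs hc hT hp (isSmoothField_constField (v, 0)),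
    leviCivita_constField, omega_lift] at h1
  have h3 : T p w (constField (v, 0) p) = lift p (omega T p w • cross p.1 v, 0) := by
    refine tangent_ext ?_ ?_
    · rw [dx_apply hs hc, dx_lift, constField, dx_lift, map_sub, map_smul, cross_self]
      simp [inner_smul_right, inner_cross_left]
    · rw [dy_apply hs hc, dy_lift]
  rw [h3, omega_lift] at h1
  have h4 : inner ℝ (mvfderiv IS2R (omegaDual T) p w) v =
      inner ℝ (omegaDual T p) (-inner ℝ (p.1 : E3) v • dx p w) -
        inner ℝ (omegaDual T p) (omega T p w • cross p.1 v) := by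
    rw [h1]
    simp
    rfl
  have h5 : inner ℝ (cross (omegaDual T p) p.1) v = inner ℝ (omegaDual T p) (cross p.1 v) := by
    simp [inner_eq]; ring
  rw [h4, inner_sub_left, real_inner_smul_left, real_inner_smul_left, real_inner_smul_right,
    real_inner_smul_right, h5]
  ring

/-- The horizontal part of `ω` vanishes: on `S²` it would be a one-form whose second derivatives
only commute if `S²` had curvature `-|ω|²`. -/
lemma omegaDual_eq_zero {T : Field12 IS2R S2R} (hs : IsSkewTensor T) (hc : PreservesCurv T)
    (hT : IsSmoothTensor T) (hp : IsParallelTensor (subTensor leviCivita T) T) (p : S2R) :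
    omegaDual T p = 0 := by
  set A := omegaDual T p with hA
  set b := cross A p.1 with hb
  have hAx : inner ℝ A (p.1 : E3) = 0 := inner_omegaDual T p
  have hAs := contMDiff_omegaDual hT
  have hAd := hAs.mdifferentiableAt (x := p) (by simp)
  have hX (v : E3) := isSmoothField_constField (v, 0)
  have hd (v : E3) : (fun q => mvfderiv IS2R (omegaDual T) q (constField (v, 0) q)) = fun q =>
      -(inner ℝ (omegaDual T q) (dx q (constField (v, 0) q)) •
        ((q.1 : E3) + cross (omegaDual T q) q.1)) := by
    funext q
    have h : omega T q (constField (v, 0) q) =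
        inner ℝ (omegaDual T q) (dx q (constField (v, 0) q)) := by
      rw [omega_eq, constField, dy_lift]
      ring
    rw [mvfderiv_omegaDual hs hc hT hp, h]
    module
  have hdd (v : E3) (u : TangentSpace IS2R p) :
      mvfderiv IS2R (fun q => mvfderiv IS2R (omegaDual T) q (constField (v, 0) q)) p u =
      -((inner ℝ A (mvfderiv IS2R (fun q => dx q (constField (v, 0) q)) p u) +
        inner ℝ (mvfderiv IS2R (omegaDual T) p u) (dx p (constField (v, 0) p))) •
        ((p.1 : E3) + b) + inner ℝ A (dx p (constField (v, 0) p)) •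
        (dx p u + (cross A (dx p u) + cross (mvfderiv IS2R (omegaDual T) p u) p.1))) := by
    have h1 := mdiff_bilinear (innerSL ℝ : E3 →L[ℝ] E3 →L[ℝ] ℝ) hAd (mdiff_dx ((hX v).mdiff p))
    have h2 := mvfderiv_bilinear (innerSL ℝ : E3 →L[ℝ] E3 →L[ℝ] ℝ) hAd
      (mdiff_dx ((hX v).mdiff p)) u
    have h3 := mdiff_bilinear cross hAd (mdiff_incl p)
    have h4 := mvfderiv_bilinear cross hAd (mdiff_incl p) u
    have h5 := congrArg (fun L => L u) (mvfderiv_fun_add (mdiff_incl p) h3)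
    have h6 := mvfderiv_bilinear (ContinuousLinearMap.lsmul ℝ ℝ) h1 ((mdiff_incl p).add h3) u
    rw [hd v, mvfderiv_fun_neg]
    refine congrArg Neg.neg (h6.trans ?_)
    rw [h2]
    refine (congrArg (fun z : E3 => inner ℝ A (dx p (constField (v, 0) p)) • z + _) h5).trans ?_
    rw [add_apply, h4]
    change inner ℝ (_ : E3) _ • (dx p u + (cross A (dx p u) + _)) +
      (inner ℝ A _ + inner ℝ (_ : E3) _) • ((p.1 : E3) + b) = _
    rw [add_comm]
  have hxA : dx p (constField (A, 0) p) = A := by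
    rw [constField, dx_lift, real_inner_comm, hAx, zero_smul, sub_zero]
  have hxb : dx p (constField (b, 0) p) = b := by
    rw [constField, dx_lift, hb, inner_cross_right, zero_smul, sub_zero]
  have hyz (v : E3) (q : S2R) : dy q (constField (v, 0) q) = 0 := dy_lift q (v, 0)
  have hcomm := mvfderiv_mlieBracket hAs (hX A) (hX b) p
  have hincl : dx p _ = mvfderiv IS2R (fun q => dx q (constField (b, 0) q)) p _ -
      mvfderiv IS2R (fun q => dx q (constField (A, 0) q)) p _ :=
    mvfderiv_mlieBracket (contMDiff_incl.of_le le_top) (hX A) (hX b) p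
  have hy : dy p _ = mvfderiv IS2R (fun q => dy q (constField (b, 0) q)) p _ -
      mvfderiv IS2R (fun q => dy q (constField (A, 0) q)) p _ :=
    mvfderiv_mlieBracket_real (contMDiff_snd (I := 𝓡 2) (J := 𝓘(ℝ, ℝ))) (hX A) (hX b) p
  simp only [hyz, mvfderiv_const] at hy
  have hω (u : TangentSpace IS2R p) (hu : dy p u = 0) : omega T p u = inner ℝ A (dx p u) := by
    rw [omega_eq, hu, zero_mul, add_zero]
  have hAb : inner ℝ A b = 0 := inner_cross_left _ _
  rw [mvfderiv_omegaDual hs hc hT hp, hω _ (by rw [hy]; simp), hdd, hdd, hxA, hxb,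
    mvfderiv_omegaDual hs hc hT hp, mvfderiv_omegaDual hs hc hT hp, hω _ (hyz _ _),
    hω _ (hyz _ _), hxA, hxb, hincl, ← hA, ← hb, hAb] at hcomm
  -- The commutator of the second derivatives along `A` and `b = A × x`, in the direction `b`.
  have h2 := congrArg (inner ℝ b) hcomm
  have hbb : inner ℝ b b = inner ℝ A A := by
    rw [hb, inner_cross_cross, inner_self_sphere, hAx]; ring
  have hbx : inner ℝ b (p.1 : E3) = 0 := by rw [real_inner_comm]; exact inner_cross_right _ _
  have hxb' : inner ℝ (p.1 : E3) b = 0 := inner_cross_right _ _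
  have hbcross : inner ℝ b (cross A b) = 0 := inner_cross_right _ _
  simp only [inner_sub_left, inner_add_right, inner_sub_right, inner_neg_right,
    real_inner_smul_left, real_inner_smul_right, hbb, hbx, hbcross, map_sub, map_smul,
    map_neg, sub_apply, smul_apply, neg_apply, cross_self, neg_smul, zero_smul, inner_neg_left,
    hxb', inner_zero_left, map_zero, zero_apply, mul_zero, neg_zero, add_zero, zero_add,
    sub_zero] at h2
  set s := inner ℝ A A with hs'
  have hs0 : 0 ≤ s := real_inner_self_nonneg
  have h3 : s * (s * (s + 1)) = 0 := by linear_combination -h2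
  have h4 : s = 0 := by
    rcases mul_eq_zero.1 h3 with h | h
    · exact h
    · rcases mul_eq_zero.1 h with h | h
      · exact h
      · linarith
  exact inner_self_eq_zero.1 h4

/-! ### Classification of the homogeneous structures -/

lemma eq_tensorT_of_isHomogeneousStructure {T : Field12 IS2R S2R}
    (h : IsHomogeneousStructure metric T) : ∃ l : ℝ, T = tensorT l := by
  obtain ⟨hT, hs, hc, hp⟩ := (isHomogeneousStructure_iff T).1 h
  refine ⟨omega T origin (vert origin), ?_⟩
  funext p
  refine ContinuousLinearMap.ext fun u => ContinuousLinearMap.ext fun v => tangent_ext ?_ ?_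
  · rw [dx_apply hs hc, dx_tensorT, omega_eq, omegaDual_eq_zero hs hc hT hp, inner_zero_left,
      zero_add, mul_comm, omega_vert hs hc hT hp p origin]
  · rw [dy_apply hs hc, dy_tensorT]

lemma isHomogeneousStructure_iff_exists (T : Field12 IS2R S2R) :
    IsHomogeneousStructure metric T ↔ ∃ l : ℝ, T = tensorT l :=
  ⟨eq_tensorT_of_isHomogeneousStructure, by
    rintro ⟨l, rfl⟩
    exact isHomogeneousStructure_tensorT l⟩

/-! ### Isomorphism classes -/

lemma dx_mfderiv {φ : S2R → S2R} {p : S2R} (hφ : MDifferentiableAt IS2R IS2R φ p)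
    (u : TangentSpace IS2R p) :
    dx (φ p) (mfderiv IS2R IS2R φ p u) = mvfderiv IS2R (fun q => ((φ q).1 : E3)) p u := by
  have h := mfderiv_comp p (mdiff_incl (φ p)) hφ
  exact (congrArg (fun L : ModelE →L[ℝ] E3 => L u) h).symm

lemma dy_mfderiv {φ : S2R → S2R} {p : S2R} (hφ : MDifferentiableAt IS2R IS2R φ p)
    (u : TangentSpace IS2R p) :
    dy (φ p) (mfderiv IS2R IS2R φ p u) = mvfderiv IS2R (fun q => (φ q).2) p u := by
  have h := mfderiv_comp p (mdiff_y (φ p)) hφ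
  exact (congrArg (fun L : ModelE →L[ℝ] ℝ => L u) h).symm

/-- The reflection `(x, y) ↦ (x, -y)`. -/
def flip : Diffeomorph IS2R IS2R S2R S2R ∞ :=
  (Diffeomorph.refl (𝓡 2) S2 ∞).prodCongr ((ContinuousLinearEquiv.neg ℝ : ℝ ≃L[ℝ] ℝ).toDiffeomorph)

lemma dx_flip (p : S2R) (u : TangentSpace IS2R p) :
    dx (flip p) (mfderiv IS2R IS2R flip p u) = dx p u :=
  dx_mfderiv (flip.mdifferentiable (by simp) p) u

lemma dy_flip (p : S2R) (u : TangentSpace IS2R p) :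
    dy (flip p) (mfderiv IS2R IS2R flip p u) = -dy p u := by
  rw [dy_mfderiv (flip.mdifferentiable (by simp) p)]
  have h : (fun q => (flip q).2) = fun q : S2R => -q.2 := rfl
  rw [h, mvfderiv_fun_neg]
  rfl

lemma isIsomorphic_neg (l : ℝ) : IsIsomorphic metric (tensorT l) metric (tensorT (-l)) := by
  refine ⟨flip, fun p u v => ?_, fun p u v => ?_⟩
  · change gInner _ _ _ = gInner _ _ _
    rw [gInner_apply, gInner_apply, dx_flip, dx_flip, dy_flip, dy_flip]
    ring
  · refine tangent_ext ?_ ?_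
    · rw [dx_flip, dx_tensorT, dx_tensorT, dx_flip, dy_flip, neg_mul_neg]
      rfl
    · rw [dy_flip, dy_tensorT, dy_tensorT, neg_zero]

lemma isIsomorphic_refl (T : Field12 IS2R S2R) : IsIsomorphic metric T metric T := by
  refine ⟨Diffeomorph.refl IS2R S2R ∞, fun p u v => ?_, fun p u v => ?_⟩
  · rw [Diffeomorph.coe_refl, mfderiv_id]; rfl
  · rw [Diffeomorph.coe_refl, mfderiv_id]; rfl

lemma gInner_tensorT_self (l : ℝ) (p : S2R) (u v : TangentSpace IS2R p) :
    gInner p (tensorT l p u v) (tensorT l p u v) =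
      l ^ 2 * (dy p u) ^ 2 * inner ℝ (dx p v) (dx p v) := by
  rw [gInner_apply, dx_tensorT, dy_tensorT, real_inner_smul_left, real_inner_smul_right,
    inner_cross_cross, inner_self_sphere, inner_dx]
  ring

lemma gInner_tensorT_self_le (l : ℝ) (p : S2R) (u v : TangentSpace IS2R p) :
    gInner p (tensorT l p u v) (tensorT l p u v) ≤ l ^ 2 * (gInner p u u * gInner p v v) := by
  rw [gInner_tensorT_self, gInner_apply, gInner_apply, mul_assoc]
  have h1 : 0 ≤ inner ℝ (dx p u) (dx p u) := real_inner_self_nonneg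
  have h2 : 0 ≤ inner ℝ (dx p v) (dx p v) := real_inner_self_nonneg
  refine mul_le_mul_of_nonneg_left (mul_le_mul ?_ ?_ h2 ?_) (sq_nonneg l)
  · nlinarith
  · nlinarith [mul_self_nonneg (dy p v)]
  · nlinarith [mul_self_nonneg (dy p u)]

/-- The operator norm of `T^l` is `|l|`, and it is attained at each point. -/
lemma exists_gInner_tensorT_self (p : S2R) : ∃ u v : TangentSpace IS2R p,
    gInner p u u = 1 ∧ gInner p v v = 1 ∧
      ∀ l, gInner p (tensorT l p u v) (tensorT l p u v) = l ^ 2 := by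
  obtain ⟨w, hw, hw1⟩ := exists_unit_orthogonal p.1
  have h : dx p (lift p (w, 0)) = w := by rw [dx_lift, hw, zero_smul, sub_zero]
  refine ⟨vert p, lift p (w, 0), ?_, ?_, fun l => ?_⟩
  · rw [gInner_apply, dx_vert, dy_vert]; simp
  · rw [gInner_apply, h, hw1, dy_lift]; simp
  · rw [gInner_tensorT_self, h, hw1, dy_vert]; simp

lemma sq_eq_of_isIsomorphic {l k : ℝ} (h : IsIsomorphic metric (tensorT l) metric (tensorT k)) :
    l ^ 2 = k ^ 2 := by
  obtain ⟨φ, hφ, hT⟩ := h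
  replace hφ : ∀ (p : S2R) (u v : TangentSpace IS2R p),
    gInner (φ p) (mfderiv IS2R IS2R φ p u) (mfderiv IS2R IS2R φ p v) = gInner p u v := hφ
  refine le_antisymm ?_ ?_
  · obtain ⟨u, v, hu, hv, h⟩ := exists_gInner_tensorT_self origin
    have h1 := gInner_tensorT_self_le k (φ origin) (mfderiv IS2R IS2R φ origin u)
      (mfderiv IS2R IS2R φ origin v)
    rw [← hT, hφ, hφ, hφ, h, hu, hv] at h1
    linarith
  · obtain ⟨u', v', hu', hv', h'⟩ := exists_gInner_tensorT_self (φ origin)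
    obtain ⟨u, rfl⟩ := (φ.mfderivToContinuousLinearEquiv (by simp) origin).surjective u'
    obtain ⟨v, rfl⟩ := (φ.mfderivToContinuousLinearEquiv (by simp) origin).surjective v'
    replace hu' : gInner (φ origin) (mfderiv IS2R IS2R φ origin u) (mfderiv IS2R IS2R φ origin u)
      = 1 := hu'
    replace hv' : gInner (φ origin) (mfderiv IS2R IS2R φ origin v) (mfderiv IS2R IS2R φ origin v)
      = 1 := hv'
    have h1 : gInner (φ origin) (tensorT k (φ origin) (mfderiv IS2R IS2R φ origin u)
      (mfderiv IS2R IS2R φ origin v)) (tensorT k (φ origin) (mfderiv IS2R IS2R φ origin u)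
      (mfderiv IS2R IS2R φ origin v)) = k ^ 2 := h' k
    have h2 := gInner_tensorT_self_le l origin u v
    rw [hφ] at hu' hv'
    rw [← hT, hφ] at h1
    rw [h1, hu', hv'] at h2
    linarith

lemma isIsomorphic_tensorT_iff (l k : ℝ) :
    IsIsomorphic metric (tensorT l) metric (tensorT k) ↔ l = k ∨ l = -k := by
  constructor
  · exact fun h => sq_eq_sq_iff_eq_or_eq_neg.1 (sq_eq_of_isIsomorphic h)
  · rintro (rfl | rfl)
    · exact isIsomorphic_refl _
    · simpa using isIsomorphic_neg (-k)

lemma existsUnique_isIsomorphic_tensorT {T : Field12 IS2R S2R}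
    (hT : IsHomogeneousStructure metric T) :
    ∃! l : ℝ, 0 ≤ l ∧ IsIsomorphic metric T metric (tensorT l) := by
  obtain ⟨l, rfl⟩ := eq_tensorT_of_isHomogeneousStructure hT
  simp only [isIsomorphic_tensorT_iff]
  refine ⟨|l|, ⟨abs_nonneg l, ?_⟩, ?_⟩
  · exact (abs_choice l).imp Eq.symm fun h => by rw [h, neg_neg]
  · rintro k ⟨hk, rfl | rfl⟩
    · exact (abs_of_nonneg hk).symm
    · rw [abs_neg, abs_of_nonneg hk]

/-! ### The action of `SO(3) × ℝ` -/

/-- The linear map of Euclidean `3`-space with a given matrix. -/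
def matCLM (A : Matrix (Fin 3) (Fin 3) ℝ) : E3 →L[ℝ] E3 :=
  LinearMap.toContinuousLinearMap (Matrix.toEuclideanLin A)

lemma matCLM_apply (A : Matrix (Fin 3) (Fin 3) ℝ) (v : E3) :
    matCLM A v = WithLp.toLp 2 (A.mulVec v.ofLp) := rfl

lemma matCLM_coord (A : Matrix (Fin 3) (Fin 3) ℝ) (v : E3) (i : Fin 3) :
    matCLM A v i = A i 0 * v 0 + A i 1 * v 1 + A i 2 * v 2 := by
  simp [matCLM_apply, Matrix.mulVec, dotProduct, Fin.sum_univ_three]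

lemma matCLM_mul (A B : Matrix (Fin 3) (Fin 3) ℝ) (v : E3) :
    matCLM (A * B) v = matCLM A (matCLM B v) := by
  simp [matCLM_apply, Matrix.mulVec_mulVec]

lemma inner_matCLM (A : SO3) (v w : E3) :
    inner ℝ (matCLM A v) (matCLM A w) = inner ℝ v w := by
  simp only [matCLM_apply, EuclideanSpace.inner_eq_star_dotProduct, star_trivial]
  rw [Matrix.dotProduct_mulVec, Matrix.vecMul_mulVec, SO3.transpose_mul, Matrix.vecMul_one]

lemma SO3.adjugate_eq (A : SO3) : (A : Matrix (Fin 3) (Fin 3) ℝ).adjugate =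
    (A : Matrix (Fin 3) (Fin 3) ℝ).transpose := by
  have h := (Matrix.mem_specialOrthogonalGroup_iff.1 A.2).2
  have h1 := Matrix.mul_adjugate (A : Matrix (Fin 3) (Fin 3) ℝ)
  rw [h, one_smul] at h1
  have h2 := congrArg ((A : Matrix (Fin 3) (Fin 3) ℝ).transpose * ·) h1
  simpa [← mul_assoc, SO3.transpose_mul] using h2

/-- Rotations preserve the vector product, because they are their own cofactor matrices. -/
lemma matCLM_cross (A : SO3) (v w : E3) :
    matCLM A (cross v w) = cross (matCLM A v) (matCLM A w) := by
  have h := SO3.adjugate_eq A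
  rw [Matrix.adjugate_fin_three] at h
  have h' (i j : Fin 3) := congrFun (congrFun h i) j
  have h00 := h' 0 0
  have h01 := h' 0 1
  have h02 := h' 0 2
  have h10 := h' 1 0
  have h11 := h' 1 1
  have h12 := h' 1 2
  have h20 := h' 2 0
  have h21 := h' 2 1
  have h22 := h' 2 2
  simp at h00 h01 h02 h10 h11 h12 h20 h21 h22
  ext i
  fin_cases i
  · simp [matCLM_coord]
    linear_combination -(v 1 * w 2 - v 2 * w 1) * h00 - (v 2 * w 0 - v 0 * w 2) * h10 -
      (v 0 * w 1 - v 1 * w 0) * h20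
  · simp [matCLM_coord]
    linear_combination -(v 1 * w 2 - v 2 * w 1) * h01 - (v 2 * w 0 - v 0 * w 2) * h11 -
      (v 0 * w 1 - v 1 * w 0) * h21
  · simp [matCLM_coord]
    linear_combination -(v 1 * w 2 - v 2 * w 1) * h02 - (v 2 * w 0 - v 0 * w 2) * h12 -
      (v 0 * w 1 - v 1 * w 0) * h22

lemma smul_fst (a : G) (p : S2R) : ((a • p).1 : E3) = matCLM a.1 p.1 := rfl

lemma smul_snd (a : G) (p : S2R) : (a • p).2 = p.2 + Multiplicative.toAdd a.2 := rfl

lemma contMDiff_smul (a : G) : ContMDiff IS2R IS2R ∞ (fun p : S2R => a • p) := by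
  have h1 : ContMDiff IS2R 𝓘(ℝ, E3) ∞ (fun p : S2R => matCLM a.1 p.1) :=
    (matCLM a.1).contMDiff.comp (contMDiff_incl.of_le (by simp))
  have h2 : ContMDiff IS2R (𝓡 2) ∞ (fun p : S2R => (a • p).1) :=
    ContMDiff.codRestrict_sphere (n := 2) h1 _
  exact h2.prodMk (contMDiff_snd.add contMDiff_const)

lemma mdiff_smul (a : G) (p : S2R) : MDifferentiableAt IS2R IS2R (fun p : S2R => a • p) p :=
  (contMDiff_smul a).mdifferentiable (by simp) p

lemma dx_smul (a : G) (p : S2R) (u : TangentSpace IS2R p) :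
    dx (a • p) (mfderiv IS2R IS2R (fun p : S2R => a • p) p u) = matCLM a.1 (dx p u) := by
  refine (dx_mfderiv (mdiff_smul a p) u).trans ?_
  exact mvfderiv_linear (matCLM a.1) (mdiff_incl p) u

lemma dy_smul (a : G) (p : S2R) (u : TangentSpace IS2R p) :
    dy (a • p) (mfderiv IS2R IS2R (fun p : S2R => a • p) p u) = dy p u := by
  refine (dy_mfderiv (mdiff_smul a p) u).trans ?_
  change mvfderiv IS2R (fun q : S2R => q.2 + Multiplicative.toAdd a.2) p u = _
  rw [mvfderiv_fun_add (mdiff_y p) mdifferentiableAt_const, mvfderiv_const]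
  exact add_zero _

lemma preservesMetric_smul (a : G) : PreservesMetric metric metric (fun p : S2R => a • p) := by
  intro p u v
  change gInner _ _ _ = gInner _ _ _
  rw [gInner_apply, gInner_apply, dx_smul, dx_smul, dy_smul, dy_smul, inner_matCLM]

lemma intertwines_tensorT (l : ℝ) (a : G) :
    Intertwines (fun p : S2R => a • p) (tensorT l) (tensorT l) := by
  intro p u v
  refine tangent_ext ?_ ?_
  · rw [dx_smul, dx_tensorT, dx_tensorT, dx_smul, dy_smul, smul_fst, map_smul, matCLM_cross]
  · rw [dy_smul, dy_tensorT, dy_tensorT]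

lemma exists_smul_origin (p : S2R) : ∃ a : G, a • origin = p := by
  obtain ⟨x, y⟩ := p
  obtain ⟨w, hw, hw1⟩ := exists_unit_orthogonal x
  -- The rotation with columns `x`, `w`, `x × w` takes the first basis vector to `x`.
  let A : Matrix (Fin 3) (Fin 3) ℝ :=
    (Matrix.of ![(x : E3).ofLp, w.ofLp, (cross x w).ofLp]).transpose
  have hx := inner_self_sphere x
  have hA : A ∈ Matrix.specialOrthogonalGroup (Fin 3) ℝ := by
    have h3 := inner_cross_cross x w x w
    have h4 := inner_cross_left x w
    have h5 := inner_cross_right x w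
    rw [hx, hw, hw1] at h3
    rw [inner_eq] at hx hw hw1 h4 h5 h3
    refine Matrix.mem_specialOrthogonalGroup_iff.2
      ⟨(Matrix.mem_orthogonalGroup_iff' _ _).2 ?_, ?_⟩
    · ext i j
      fin_cases i <;> fin_cases j <;>
        simp [A, Matrix.mul_apply, Fin.sum_univ_three] at * <;> linarith
    · simp [A, Matrix.det_fin_three] at *
      linarith
  refine ⟨(⟨A, hA⟩, Multiplicative.ofAdd y), Prod.ext (Subtype.ext ?_) (zero_add y)⟩
  rw [smul_fst]
  ext i
  fin_cases i <;> simp [matCLM_coord, A, origin]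

lemma isPretransitive : MulAction.IsPretransitive G S2R :=
  MulAction.isPretransitive_iff_base origin |>.2 exists_smul_origin

lemma faithfulSMul : FaithfulSMul G S2R where
  eq_of_smul_eq_smul {a b} h := by
    refine Prod.ext (Subtype.ext ?_) ?_
    · ext i j
      have h1 := congrArg (fun p : S2R => (p.1 : E3) i) (h (⟨stdVec j, by simp⟩, 0))
      simp only [smul_fst, matCLM_coord] at h1
      fin_cases j <;> simpa [stdVec] using h1
    · have h2 := congrArg Prod.snd (h origin)
      simpa [smul_snd] using h2

/-! ### The isotropy group -/

lemma mem_isotropy_iff (a : G) : a ∈ isotropy ↔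
    ((∀ i, (a.1 : Matrix (Fin 3) (Fin 3) ℝ) i 0 = if i = 0 then 1 else 0) ∧
      Multiplicative.toAdd a.2 = 0) := by
  rw [MulAction.mem_stabilizer_iff, Prod.ext_iff, Subtype.ext_iff, smul_fst, smul_snd]
  refine and_congr ?_ ?_
  · rw [WithLp.ext_iff, funext_iff]
    refine forall_congr' fun i => ?_
    fin_cases i <;> simp [matCLM_coord, origin]
  · simp [origin]

/-- The block matrix with blocks `1` and `B`. -/
def blockMatrix (B : Matrix (Fin 2) (Fin 2) ℝ) : Matrix (Fin 3) (Fin 3) ℝ :=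
  !![1, 0, 0; 0, B 0 0, B 0 1; 0, B 1 0, B 1 1]

lemma mem_SO2_iff (B : Matrix (Fin 2) (Fin 2) ℝ) :
    blockMatrix B ∈ Matrix.specialOrthogonalGroup (Fin 3) ℝ ↔
      B ∈ Matrix.specialOrthogonalGroup (Fin 2) ℝ := by
  rw [Matrix.mem_specialOrthogonalGroup_iff, Matrix.mem_specialOrthogonalGroup_iff,
    Matrix.mem_orthogonalGroup_iff, Matrix.mem_orthogonalGroup_iff]
  refine and_congr ?_ ?_
  · rw [← Matrix.ext_iff, ← Matrix.ext_iff]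
    simp [Fin.forall_fin_succ, Matrix.mul_apply, Fin.sum_univ_succ, blockMatrix]
  · simp [blockMatrix, Matrix.det_fin_three, Matrix.det_fin_two]

/-- The isotropy group consists of the rotations about the first axis. -/
lemma eq_blockMatrix {a : G} (ha : a ∈ isotropy) : (a.1 : Matrix (Fin 3) (Fin 3) ℝ) =
    blockMatrix ((a.1 : Matrix (Fin 3) (Fin 3) ℝ).submatrix Fin.succ Fin.succ) := by
  have h0 := ((mem_isotropy_iff a).1 ha).1
  have h1 := SO3.transpose_mul a.1
  have h2 (j : Fin 3) := congrFun (congrFun h1 0) j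
  simp only [Matrix.mul_apply, Matrix.transpose_apply, h0, Fin.sum_univ_three] at h2
  ext i j
  fin_cases j
  · have := h0 i
    fin_cases i <;> simpa [blockMatrix] using this
  · have := h2 1
    fin_cases i <;> simp_all [blockMatrix]
  · have := h2 2
    fin_cases i <;> simp_all [blockMatrix]

/-- The isotropy group of the origin is `SO(2)`. -/
def isotropyEquiv : isotropy ≃ₜ* Matrix.specialOrthogonalGroup (Fin 2) ℝ where
  toFun a := ⟨((a : G).1 : Matrix (Fin 3) (Fin 3) ℝ).submatrix Fin.succ Fin.succ, by
    rw [← mem_SO2_iff, ← eq_blockMatrix a.2]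
    exact (a : G).1.2⟩
  invFun B := ⟨(⟨blockMatrix B, (mem_SO2_iff B).2 B.2⟩, 1), by
    rw [mem_isotropy_iff]
    refine ⟨fun i => ?_, rfl⟩
    fin_cases i <;> simp [blockMatrix]⟩
  left_inv a := Subtype.ext (Prod.ext (Subtype.ext (eq_blockMatrix a.2).symm)
    ((mem_isotropy_iff a).1 a.2).2.symm)
  right_inv B := by
    ext i j
    fin_cases i <;> fin_cases j <;> rfl
  map_mul' a b := by
    have ha := ((mem_isotropy_iff a).1 a.2).1
    have hb := ((mem_isotropy_iff b).1 b.2).1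
    ext i j
    change (((a : G).1 : Matrix (Fin 3) (Fin 3) ℝ) * ((b : G).1 : Matrix (Fin 3) (Fin 3) ℝ))
      i.succ j.succ = _
    rw [Matrix.mul_apply, Fin.sum_univ_succ, ha]
    simp [Matrix.mul_apply]
  continuous_toFun := by
    refine Continuous.subtype_mk (Continuous.matrix_submatrix ?_ _ _) _
    exact continuous_subtype_val.comp (continuous_fst.comp continuous_subtype_val)
  continuous_invFun := by
    refine Continuous.subtype_mk (Continuous.prodMk (Continuous.subtype_mk ?_ _)
      continuous_const) _
    refine continuous_matrix fun i j => ?_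
    have h (i j : Fin 2) : Continuous fun B : Matrix.specialOrthogonalGroup (Fin 2) ℝ =>
        (B : Matrix (Fin 2) (Fin 2) ℝ) i j := continuous_subtype_val.matrix_elem i j
    fin_cases i <;> fin_cases j <;> simp [blockMatrix, continuous_const, h]

/-! ### Fundamental vector fields -/

lemma contDiff_exp_smul_mulVec (A : Matrix (Fin 3) (Fin 3) ℝ) (v : E3) :
    ContDiff ℝ ∞ (fun t : ℝ => matCLM (NormedSpace.exp (t • A)) v) := by
  let _ : NormedRing (Matrix (Fin 3) (Fin 3) ℝ) := Matrix.linftyOpNormedRing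
  let _ : NormedAlgebra ℝ (Matrix (Fin 3) (Fin 3) ℝ) := Matrix.linftyOpNormedAlgebra
  have h1 : ContDiff ℝ ∞ (fun B : Matrix (Fin 3) (Fin 3) ℝ => NormedSpace.exp B) :=
    contDiff_iff_contDiffAt.2 fun B => (NormedSpace.exp_analytic (𝕂 := ℝ) B).contDiffAt
  have h2 : ContDiff ℝ ∞ (fun t : ℝ => t • A) := contDiff_id.smul contDiff_const
  have h3 := ((Matrix.mulVecBilin ℝ ℝ).flip v.ofLp).toContinuousLinearMap.contDiff.comp
    (h1.comp h2)
  exact (EuclideanSpace.equiv (Fin 3) ℝ).symm.contDiff.comp h3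

lemma hasDerivAt_exp_smul_mulVec (A : Matrix (Fin 3) (Fin 3) ℝ) (v : E3) :
    HasDerivAt (fun t : ℝ => matCLM (NormedSpace.exp (t • A)) v) (matCLM A v) 0 := by
  let _ : NormedRing (Matrix (Fin 3) (Fin 3) ℝ) := Matrix.linftyOpNormedRing
  let _ : NormedAlgebra ℝ (Matrix (Fin 3) (Fin 3) ℝ) := Matrix.linftyOpNormedAlgebra
  have h1 := hasDerivAt_exp_smul_const (𝕂 := ℝ) A 0
  rw [zero_smul, NormedSpace.exp_zero, one_mul] at h1
  have h2 := ((Matrix.mulVecBilin ℝ ℝ).flip v.ofLp).toContinuousLinearMap.hasFDerivAt.comp_hasDerivAt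
    0 h1
  exact (EuclideanSpace.equiv (Fin 3) ℝ).symm.toContinuousLinearMap.hasFDerivAt.comp_hasDerivAt 0 h2

lemma hasMFDerivAt_expG_smul (X : LieG) (p : S2R) :
    HasMFDerivAt 𝓘(ℝ, ℝ) IS2R (fun t : ℝ => expG (t • X) • p) 0
      (mfderiv 𝓘(ℝ, ℝ) IS2R (fun t : ℝ => expG (t • X) • p) 0) := by
  have h1 : ContMDiff 𝓘(ℝ, ℝ) 𝓘(ℝ, E3) ∞
      (fun t : ℝ => matCLM (NormedSpace.exp (t • (X.1 : Matrix (Fin 3) (Fin 3) ℝ))) p.1) :=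
    (contDiff_exp_smul_mulVec X.1 p.1).contMDiff
  have h2 : ContMDiff 𝓘(ℝ, ℝ) (𝓡 2) ∞ (fun t : ℝ => (expG (t • X) • p).1) :=
    ContMDiff.codRestrict_sphere (n := 2) h1 _
  have h3 : ContMDiff 𝓘(ℝ, ℝ) 𝓘(ℝ, ℝ) ∞ (fun t : ℝ => (expG (t • X) • p).2) := by
    have : ContDiff ℝ ∞ (fun t : ℝ => p.2 + t * X.2) := by fun_prop
    exact this.contMDiff
  exact ((h2.prodMk h3).mdifferentiableAt (by simp)).hasMFDerivAt

lemma expG_zero_smul (X : LieG) (p : S2R) : expG ((0 : ℝ) • X) • p = p := by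
  refine Prod.ext (Subtype.ext ?_) ?_
  · rw [smul_fst]
    simp [expG, matCLM_apply]
  · simp [smul_snd, expG]

lemma dx_fundamentalField (X : LieG) (p : S2R) : dx p (fundamentalField X p) = matCLM X.1 p.1 := by
  have h := hasDerivAt_comp_curve (hasMFDerivAt_expG_smul X p) (mdiff_incl _)
  have h1 := h.unique (hasDerivAt_exp_smul_mulVec X.1 p.1)
  rw [← h1]
  exact congrArg (fun q => (dx q : ModelE →L[ℝ] E3) (fundamentalField X p))
    (expG_zero_smul X p).symm

lemma dy_fundamentalField (X : LieG) (p : S2R) : dy p (fundamentalField X p) = X.2 := by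
  have h := hasDerivAt_comp_curve (hasMFDerivAt_expG_smul X p) (mdiff_y _)
  have h2 : HasDerivAt (fun t : ℝ => p.2 + t * X.2) X.2 0 := by
    simpa using ((hasDerivAt_id (0 : ℝ)).mul_const X.2).const_add p.2
  rw [← h.unique h2]
  exact congrArg (fun q => (dy q : ModelE →L[ℝ] ℝ) (fundamentalField X p))
    (expG_zero_smul X p).symm

lemma isSmoothField_fundamentalField (X : LieG) : IsSmoothField (fundamentalField X) := by
  rw [isSmoothField_iff]
  simp only [dx_fundamentalField, dy_fundamentalField]
  exact ⟨(matCLM X.1).contMDiff.comp (contMDiff_incl.of_le (by simp)), contMDiff_const⟩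

lemma fundamentalField_origin_eq {X Y : LieG} (h : X - Y ∈ isotropyAlgebra) :
    fundamentalField X origin = fundamentalField Y origin := by
  obtain ⟨h1, h2⟩ := (forall_expG_mem_isotropy _).1 h
  refine tangent_ext ?_ ?_
  · rw [dx_fundamentalField, dx_fundamentalField, ← sub_eq_zero]
    have h3 := congrArg (WithLp.toLp 2) h1
    simpa [matCLM_apply, Matrix.sub_mulVec] using h3
  · rw [dy_fundamentalField, dy_fundamentalField]
    exact sub_eq_zero.1 h2

/-- For the Levi-Civita connection, `∇_{X^*} Y^*` at `(x, y)` is the tangential part of `Y X x`. -/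
lemma dx_covDeriv_fundamentalField {D : AffineConnection IS2R S2R} (hD : IsLeviCivita metric D)
    (X Y : LieG) (p : S2R) :
    dx p (covDeriv D (fundamentalField X) (fundamentalField Y) p) =
      matCLM Y.1 (matCLM X.1 p.1) + inner ℝ (matCLM X.1 p.1) (matCLM Y.1 p.1) • (p.1 : E3) := by
  have hY := (isSmoothField_fundamentalField Y).mdiff p
  rw [covDeriv, eq_leviCivita hD hY, dx_leviCivita hY]
  simp only [dx_fundamentalField]
  congr 1
  refine (mvfderiv_linear (matCLM Y.1) (mdiff_incl p) _).trans ?_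
  exact congrArg _ (dx_fundamentalField X p)

lemma dy_covDeriv_fundamentalField {D : AffineConnection IS2R S2R} (hD : IsLeviCivita metric D)
    (X Y : LieG) (p : S2R) :
    dy p (covDeriv D (fundamentalField X) (fundamentalField Y) p) = 0 := by
  have hY := (isSmoothField_fundamentalField Y).mdiff p
  rw [covDeriv, eq_leviCivita hD hY, dy_leviCivita]
  simp only [dy_fundamentalField]
  rw [mvfderiv_const]
  rfl

lemma matCLM_bracket (X Y : LieG) (v : E3) : matCLM (bracket X Y).1 v =
    matCLM X.1 (matCLM Y.1 v) - matCLM Y.1 (matCLM X.1 v) := by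
  rw [← matCLM_mul, ← matCLM_mul]
  simp [matCLM_apply, bracket, LieSubalgebra.coe_bracket, Ring.lie_def, Matrix.sub_mulVec]

/-- The condition defining the canonical connection, in coordinates. The `m`-projection plays no
role beyond fixing values at the origin, as the isotropy algebra vanishes there. -/
lemma canonical_iff {D : AffineConnection IS2R S2R} (hD : IsLeviCivita metric D)
    (T : Field12 IS2R S2R) {m : Submodule ℝ LieG} (hm : IsCompl m isotropyAlgebra) (X Y : LieG) :
    covDeriv (subTensor D T) (fundamentalField X) (fundamentalField Y) origin =
        -fundamentalField (m.projection isotropyAlgebra hm (bracket X Y)) origin ↔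
      dx origin (T origin (fundamentalField X origin) (fundamentalField Y origin)) =
        matCLM X.1 (matCLM Y.1 origin.1) +
          inner ℝ (matCLM X.1 origin.1) (matCLM Y.1 origin.1) • (origin.1 : E3) ∧
      dy origin (T origin (fundamentalField X origin) (fundamentalField Y origin)) = 0 := by
  have hproj : fundamentalField (m.projection isotropyAlgebra hm (bracket X Y)) origin =
      fundamentalField (bracket X Y) origin := by
    refine (fundamentalField_origin_eq ?_).symm
    rw [← Submodule.projection_apply_eq_zero_iff hm, map_sub,
      Submodule.projection_apply_of_mem_left hm (Submodule.projection_apply_mem hm _), sub_self]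
  have hT : covDeriv (subTensor D T) (fundamentalField X) (fundamentalField Y) origin =
      covDeriv D (fundamentalField X) (fundamentalField Y) origin -
        T origin (fundamentalField X origin) (fundamentalField Y origin) := subTensor_apply _ _ _ _ _
  rw [hproj, hT]
  have hx := dx_covDeriv_fundamentalField hD X Y origin
  have hy := dy_covDeriv_fundamentalField hD X Y origin
  constructor
  · intro h
    have h1 := congrArg (dx origin) h
    have h2 := congrArg (dy origin) h
    rw [map_sub, map_neg, hx, dx_fundamentalField, matCLM_bracket] at h1
    rw [map_sub, map_neg, hy, dy_fundamentalField] at h2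
    refine ⟨?_, ?_⟩
    · rw [sub_eq_iff_eq_add, neg_sub, sub_add_eq_add_sub, eq_sub_iff_add_eq] at h1
      rw [← add_right_inj (matCLM Y.1 (matCLM X.1 origin.1)), ← h1]
      abel
    · simpa [bracket] using h2
  · rintro ⟨h1, h2⟩
    refine tangent_ext ?_ ?_
    · rw [map_sub, map_neg, hx, h1, dx_fundamentalField, matCLM_bracket]
      abel
    · rw [map_sub, map_neg, hy, h2, dy_fundamentalField]
      simp [bracket]

/-! ### Reductive decompositions -/

/-- The element of `so(3)` with entries `b`, `c`, `d` below the diagonal. -/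
def soMk (b c d : ℝ) : LieAlgebra.Orthogonal.so (Fin 3) ℝ :=
  ⟨!![0, -b, -c; b, 0, -d; c, d, 0], by
    rw [LieAlgebra.Orthogonal.mem_so]
    ext i j
    fin_cases i <;> fin_cases j <;> simp⟩

lemma so_skew (X : LieAlgebra.Orthogonal.so (Fin 3) ℝ) (i j : Fin 3) :
    (X : Matrix (Fin 3) (Fin 3) ℝ) i j = -(X : Matrix (Fin 3) (Fin 3) ℝ) j i :=
  congrFun (congrFun ((LieAlgebra.Orthogonal.mem_so _ _ _).1 X.2) j) i

lemma so_diag (X : LieAlgebra.Orthogonal.so (Fin 3) ℝ) (i : Fin 3) :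
    (X : Matrix (Fin 3) (Fin 3) ℝ) i i = 0 := by
  have := so_skew X i i
  linarith

lemma so_ext {X Y : LieAlgebra.Orthogonal.so (Fin 3) ℝ}
    (h1 : (X : Matrix (Fin 3) (Fin 3) ℝ) 1 0 = (Y : Matrix (Fin 3) (Fin 3) ℝ) 1 0)
    (h2 : (X : Matrix (Fin 3) (Fin 3) ℝ) 2 0 = (Y : Matrix (Fin 3) (Fin 3) ℝ) 2 0)
    (h3 : (X : Matrix (Fin 3) (Fin 3) ℝ) 2 1 = (Y : Matrix (Fin 3) (Fin 3) ℝ) 2 1) : X = Y := by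
  ext i j
  fin_cases i <;> fin_cases j <;>
    simp [so_diag, so_skew _ 0 1, so_skew _ 0 2, so_skew _ 1 2, h1, h2, h3]

lemma mem_isotropyAlgebra_iff (X : LieG) : X ∈ isotropyAlgebra ↔
    (X.1 : Matrix (Fin 3) (Fin 3) ℝ) 1 0 = 0 ∧ (X.1 : Matrix (Fin 3) (Fin 3) ℝ) 2 0 = 0 ∧
      X.2 = 0 := by
  refine (forall_expG_mem_isotropy X).trans ?_
  rw [← and_assoc]
  refine and_congr_left fun _ => ?_
  rw [funext_iff, Fin.forall_fin_succ, Fin.forall_fin_two]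
  simp [origin, so_diag]

/-- The complement of the isotropy algebra in which the rotation about the first axis has `l` times
the speed of the translation. -/
def complement (l : ℝ) : Submodule ℝ LieG where
  carrier := {X | (X.1 : Matrix (Fin 3) (Fin 3) ℝ) 2 1 = l * X.2}
  add_mem' {X Y} hX hY := by
    simp only [Set.mem_ofPred_eq] at hX hY ⊢
    simp [hX, hY, mul_add]
  zero_mem' := by simp
  smul_mem' c X hX := by
    simp only [Set.mem_ofPred_eq] at hX ⊢
    simp [hX]
    ring

lemma mem_complement {l : ℝ} {X : LieG} :
    X ∈ complement l ↔ (X.1 : Matrix (Fin 3) (Fin 3) ℝ) 2 1 = l * X.2 := Iff.rfl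

lemma isReductive_complement (l : ℝ) : IsReductive (complement l) where
  isCompl := by
    refine ⟨Submodule.disjoint_def.2 fun X h1 h2 => ?_, ?_⟩
    · rw [mem_complement] at h1
      obtain ⟨h2, h3, h4⟩ := (mem_isotropyAlgebra_iff X).1 h2
      rw [h4, mul_zero] at h1
      exact Prod.ext (so_ext (by simp [h2]) (by simp [h3]) (by simp [h1])) h4
    · rw [Submodule.codisjoint_iff_exists_add_eq]
      intro Z
      let W : LieG := (soMk 0 0 ((Z.1 : Matrix (Fin 3) (Fin 3) ℝ) 2 1 - l * Z.2), 0)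
      refine ⟨Z - W, W, ?_, ?_, sub_add_cancel Z W⟩
      · rw [mem_complement]
        simp [W, soMk]
      · rw [mem_isotropyAlgebra_iff]
        simp [W, soMk]
  ad_mem a ha X hX := by
    have h1 := eq_blockMatrix ha
    have h2 := (Matrix.mem_specialOrthogonalGroup_iff.1 a.1.2).2
    rw [mem_complement] at hX ⊢
    change ((a.1 : Matrix (Fin 3) (Fin 3) ℝ) * X.1 *
      (a.1 : Matrix (Fin 3) (Fin 3) ℝ).transpose) 2 1 = l * X.2
    rw [← hX]
    rw [h1] at h2 ⊢
    simp [blockMatrix, Matrix.det_fin_three] at h2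
    simp only [Matrix.mul_apply, Matrix.transpose_apply, Fin.sum_univ_three]
    simp [blockMatrix, so_diag, so_skew X.1 1 2]
    linear_combination (X.1 : Matrix (Fin 3) (Fin 3) ℝ) 2 1 * h2

/-- On a reductive complement, the speed of rotation about the first axis is a fixed multiple of
the speed of translation. -/
lemma IsReductive.exists_le_complement {m : Submodule ℝ LieG} (hm : IsReductive m) :
    ∃ l, m ≤ complement l := by
  -- The half-turn `s` about the first axis: `X + Ad s X` lies in `h ⊕ ℝ`.
  let s : G := (⟨blockMatrix (-1), (mem_SO2_iff _).2
    (Matrix.mem_specialOrthogonalGroup_iff.2 ⟨(Matrix.mem_orthogonalGroup_iff _ _).2 (by simp),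
      by simp [Matrix.det_fin_two]⟩)⟩, 1)
  have hs : s ∈ isotropy := by
    rw [mem_isotropy_iff]
    refine ⟨fun i => ?_, rfl⟩
    fin_cases i <;> simp [s, blockMatrix]
  have key (X : LieG) (hX : X ∈ m) (h2 : X.2 = 0) : (X.1 : Matrix (Fin 3) (Fin 3) ℝ) 2 1 = 0 := by
    have h3 : X + Ad s X ∈ m := m.add_mem hX (hm.ad_mem s hs X hX)
    have hcoe : ((X + Ad s X).1 : Matrix (Fin 3) (Fin 3) ℝ) = (X.1 : Matrix (Fin 3) (Fin 3) ℝ) +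
        blockMatrix (-1) * X.1 * (blockMatrix (-1)).transpose := rfl
    have h4 : X + Ad s X ∈ isotropyAlgebra := by
      rw [mem_isotropyAlgebra_iff, hcoe]
      refine ⟨?_, ?_, ?_⟩
      · rw [Matrix.add_apply]
        simp only [Matrix.mul_apply, Matrix.transpose_apply, Fin.sum_univ_three]
        simp [blockMatrix]
      · rw [Matrix.add_apply]
        simp only [Matrix.mul_apply, Matrix.transpose_apply, Fin.sum_univ_three]
        simp [blockMatrix]
      · change X.2 + X.2 = 0
        rw [h2, add_zero]
    have h5 := congrArg (fun Z : LieG => (Z.1 : Matrix (Fin 3) (Fin 3) ℝ) 2 1)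
      (Submodule.disjoint_def.1 hm.isCompl.disjoint _ h3 h4)
    simp only [hcoe] at h5
    rw [Matrix.add_apply] at h5
    simp only [Matrix.mul_apply, Matrix.transpose_apply, Fin.sum_univ_three] at h5
    simp [blockMatrix] at h5
    linarith
  obtain ⟨X₀, W, hX₀, hW, h⟩ := (Submodule.codisjoint_iff_exists_add_eq.1 hm.isCompl.codisjoint)
    ((0, 1) : LieG)
  have hW2 := ((mem_isotropyAlgebra_iff W).1 hW).2.2
  have h1 : X₀.2 = 1 := by
    have := congrArg Prod.snd h
    simpa [hW2] using this
  refine ⟨(X₀.1 : Matrix (Fin 3) (Fin 3) ℝ) 2 1, fun X hX => ?_⟩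
  have h2 := key (X - X.2 • X₀) (m.sub_mem hX (m.smul_mem _ hX₀)) (by simp [h1])
  rw [mem_complement]
  simp at h2
  linarith

/-- On `complement l` the tensor of the canonical connection at the origin is `T^l`. -/
lemma dx_tensorT_fundamentalField {l : ℝ} {X : LieG} (hX : X ∈ complement l) (Y : LieG) :
    dx origin (tensorT l origin (fundamentalField X origin) (fundamentalField Y origin)) =
      matCLM X.1 (matCLM Y.1 origin.1) +
          inner ℝ (matCLM X.1 origin.1) (matCLM Y.1 origin.1) • (origin.1 : E3) := by
  rw [dx_tensorT, dx_fundamentalField, dy_fundamentalField, ← mem_complement.1 hX, inner_eq]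
  ext i
  fin_cases i <;> simp [matCLM_coord, origin, so_diag, so_skew X.1 0 1, so_skew X.1 0 2,
    so_skew X.1 1 2]
  ring

/-- A reductive complement is mapped onto the tangent space at the origin. -/
lemma exists_fundamentalField_eq {m : Submodule ℝ LieG} (hm : IsCompl m isotropyAlgebra)
    (u : TangentSpace IS2R origin) : ∃ X ∈ m, fundamentalField X origin = u := by
  let Z : LieG := (soMk (dx origin u 1) (dx origin u 2) 0, dy origin u)
  obtain ⟨X, W, hX, hW, h⟩ := (Submodule.codisjoint_iff_exists_add_eq.1 hm.codisjoint) Z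
  refine ⟨X, hX, ?_⟩
  have h1 : fundamentalField X origin = fundamentalField Z origin := by
    refine (fundamentalField_origin_eq ?_).symm
    rwa [← h, add_sub_cancel_left]
  have h0 := inner_dx origin u
  rw [inner_eq] at h0
  simp [origin] at h0
  rw [h1]
  refine tangent_ext ?_ (dy_fundamentalField Z origin)
  rw [dx_fundamentalField]
  ext i
  fin_cases i
  · simp [matCLM_coord, Z, soMk, origin]
    exact h0.symm
  · simp [matCLM_coord, Z, soMk, origin]
  · simp [matCLM_coord, Z, soMk, origin]

lemma isTensorOfDecomposition_complement (l : ℝ) :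
    IsTensorOfDecomposition (complement l) (tensorT l) where
  reductive := isReductive_complement l
  invariant := intertwines_tensorT l
  canonical := ⟨leviCivita, isLeviCivita_leviCivita, fun X hX Y _ =>
    (canonical_iff isLeviCivita_leviCivita _ _ X Y).2
      ⟨dx_tensorT_fundamentalField hX Y, dy_tensorT _ _ _ _⟩⟩

/-- Two invariant tensors that agree at the origin agree everywhere. -/
lemma eq_of_intertwines {T T' : Field12 IS2R S2R}
    (hT : ∀ a : G, Intertwines (fun p : S2R => a • p) T T)
    (hT' : ∀ a : G, Intertwines (fun p : S2R => a • p) T' T')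
    (h : ∀ u v, T origin u v = T' origin u v) : T = T' := by
  funext p
  refine ContinuousLinearMap.ext fun u => ContinuousLinearMap.ext fun v => ?_
  obtain ⟨a, ha⟩ := isPretransitive.exists_smul_eq p origin
  have h' : ∀ q, q = origin → ∀ u v, T q u v = T' q u v := by
    rintro _ rfl
    exact h
  have key : mfderiv IS2R IS2R (fun p : S2R => a • p) p (T p u v) =
      mfderiv IS2R IS2R (fun p : S2R => a • p) p (T' p u v) := by
    rw [hT a p u v, hT' a p u v]
    exact h' _ ha _ _
  refine tangent_ext ?_ ?_
  · have h1 : matCLM a.1 (dx p (T p u v)) = matCLM a.1 (dx p (T' p u v)) := by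
      rw [← dx_smul, ← dx_smul, key]
    have h2 (w : E3) : matCLM (a.1⁻¹ : SO3) (matCLM a.1 w) = w := by
      rw [← matCLM_mul, SO3.coe_inv, SO3.transpose_mul]
      simp [matCLM_apply]
    rw [← h2 (dx p (T p u v)), h1, h2]
  · rw [← dy_smul a p, ← dy_smul a p, key]

lemma IsTensorOfDecomposition.exists_eq_tensorT {m : Submodule ℝ LieG} {T : Field12 IS2R S2R}
    (h : IsTensorOfDecomposition m T) : ∃ l, T = tensorT l := by
  obtain ⟨l, hl⟩ := h.reductive.exists_le_complement
  obtain ⟨D, hD, hc⟩ := h.canonical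
  refine ⟨l, eq_of_intertwines h.invariant (intertwines_tensorT l) fun u v => ?_⟩
  obtain ⟨X, hX, rfl⟩ := exists_fundamentalField_eq h.reductive.isCompl u
  obtain ⟨Y, hY, rfl⟩ := exists_fundamentalField_eq h.reductive.isCompl v
  obtain ⟨h1, h2⟩ := (canonical_iff hD T h.reductive.isCompl X Y).1 (hc X hX Y hY)
  refine tangent_ext ?_ ?_
  · rw [h1, dx_tensorT_fundamentalField (hl hX)]
  · rw [h2, dy_tensorT]

lemma isHomogeneousStructure_iff_isTensorOfDecomposition (T : Field12 IS2R S2R) :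
    IsHomogeneousStructure metric T ↔ ∃ m : Submodule ℝ LieG, IsTensorOfDecomposition m T := by
  rw [isHomogeneousStructure_iff_exists]
  constructor
  · rintro ⟨l, rfl⟩
    exact ⟨complement l, isTensorOfDecomposition_complement l⟩
  · rintro ⟨m, hm⟩
    exact hm.exists_eq_tensorT

end HomogeneousStructures

end

open HomogeneousStructures in
theorem theorem1 :
    -- the homogeneous Riemannian structure tensors on `S² × ℝ` are the `T^l` with `l` real
    (∀ T : Field12 IS2R S2R, IsHomogeneousStructure metric T ↔ ∃ l : ℝ, T = tensorT l) ∧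
    -- up to isomorphism, each of them is `T^l` for a unique `l ≥ 0`
    (∀ T : Field12 IS2R S2R, IsHomogeneousStructure metric T →
      ∃! l : ℝ, 0 ≤ l ∧ IsIsomorphic metric T metric (tensorT l)) ∧
    -- `T^l` and `T^k` are isomorphic if and only if `l = ± k`
    (∀ l k : ℝ, IsIsomorphic metric (tensorT l) metric (tensorT k) ↔ l = k ∨ l = -k) ∧
    -- `S² × ℝ` is the coset space `SO(3) × ℝ / SO(2)`: the group acts transitively, effectively
    -- and by isometries, with isotropy group `SO(2)`
    (MulAction.IsPretransitive G S2R ∧ FaithfulSMul G S2R ∧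
      (∀ a : G, ContMDiff IS2R IS2R ∞ (fun p : S2R => a • p) ∧
        PreservesMetric metric metric (fun p : S2R => a • p)) ∧
      Nonempty (isotropy ≃ₜ* Matrix.specialOrthogonalGroup (Fin 2) ℝ)) ∧
    -- the homogeneous Riemannian structure tensors are those of its reductive decompositions
    (∀ T : Field12 IS2R S2R, IsHomogeneousStructure metric T ↔
      ∃ m : Submodule ℝ LieG, IsTensorOfDecomposition m T) :=
  ⟨isHomogeneousStructure_iff_exists, fun _ hT => existsUnique_isIsomorphic_tensorT hT,
    isIsomorphic_tensorT_iff,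
    ⟨isPretransitive, faithfulSMul, fun a => ⟨contMDiff_smul a, preservesMetric_smul a⟩,
      ⟨isotropyEquiv⟩⟩,
    isHomogeneousStructure_iff_isTensorOfDecomposition⟩
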